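/- For a matrix $D\in\mathbb{F}_2^{n\times m}$ and real $\delta,\epsilon>0$, call $D$ an $(n,m,\delta,\epsilon)$-distinguisher if for all row vectors $x,y\in\mathbb{F}_2^n$, $d_H(x,y)\ge\epsilon n$ implies $d_H(xD,yD)\ge\delta m$, where $d_H$ is the Hamming distance. The weight of $D$ is the maximum Hamming weight of a column of $D$. **Theorem.** There is $n_0\in\mathbb{N}$ such that for every natural number $n\ge n_0$ and every rational $0<\epsilon<1$ there exist $m=m(n,\epsilon)$ with $1\le m\le n^{11}$ and an $(n,m,1/16,\epsilon)$-distinguisher $D=D(n,\epsilon)$ of weight at most $8\log_2(2n)/\epsilon$. Moreover, $D$ is strongly explicit: there is a single algorithm (a Turing machine) that, given a natural number $n\ge n_0$, a rational $0<\epsilon<1$ (as numerator and denominator) and natural numbers $i,j$, all written in binary, rejects if $i\notin\{1,\dots,n\}$ or $j\notin\{1,\dots,m(n,\epsilon)\}$, and otherwise outputs the entry $D(n,\epsilon)_{ij}$, in time polynomial in the length of its input. -/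

import Mathlib

/-- `D` is an `(n, m, δ, ε)`-distinguisher: vectors of `𝔽₂ⁿ` at Hamming distance at least `ε n`
are mapped by `x ↦ x D` to vectors at Hamming distance at least `δ m`. -/
def IsDistinguisher {n m : ℕ} (δ ε : ℝ) (D : Matrix (Fin n) (Fin m) (ZMod 2)) : Prop :=
  ∀ x y : Fin n → ZMod 2,
    ε * (n : ℝ) ≤ (hammingDist x y : ℝ) →
      δ * (m : ℝ) ≤ (hammingDist (Matrix.vecMul x D) (Matrix.vecMul y D) : ℝ)

/-- The weight of a binary matrix: the maximum Hamming weight of a column. -/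
def matrixWeight {n m : ℕ} (D : Matrix (Fin n) (Fin m) (ZMod 2)) : ℕ :=
  Finset.univ.sup fun j : Fin m => hammingNorm fun i : Fin n => D i j

/-- The entry of `D` in row `i` and column `j`, counted from `1`; `none` (rejection) if `i` is not
in `{1, …, n}` or `j` is not in `{1, …, m}`. -/
def entryOrReject {n m : ℕ} (D : Matrix (Fin n) (Fin m) (ZMod 2)) (i j : ℕ) : Option (ZMod 2) :=
  if h : (1 ≤ i ∧ i ≤ n) ∧ (1 ≤ j ∧ j ≤ m) then
    some (D ⟨i - 1, by omega⟩ ⟨j - 1, by omega⟩)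
  else none

/-- The inputs of the entry algorithm: `n ≥ n₀`, a rational `0 < ε < 1`, and arbitrary natural
numbers `i`, `j`. -/
structure EntryQuery (n₀ : ℕ) where
  n : ℕ
  ε : ℚ
  i : ℕ
  j : ℕ
  large : n₀ ≤ n
  pos : 0 < ε
  lt_one : ε < 1

/-- A tuple of natural numbers as a string: each number in binary, followed by a comma. -/
def encodeTuple (l : List ℕ) : List Computability.Γ' :=
  l.flatMap fun k => (Computability.encodeNat k).map Computability.Γ'.bit ++ [Computability.Γ'.comma]

/-- The input string: `n`, the numerator and the denominator (in lowest terms) of the positive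
rational `ε`, then `i` and `j`, all in binary. -/
def EntryQuery.encode {n₀ : ℕ} (q : EntryQuery n₀) : List Computability.Γ' :=
  encodeTuple [q.n, q.ε.num.natAbs, q.ε.den, q.i, q.j]

/-- The output string: empty for rejection, otherwise the single bit of the entry. -/
def encodeAnswer : Option (ZMod 2) → List Bool
  | none => []
  | some b => [decide (b = 1)]

/-- The family `D n ε` of matrices is strongly explicit for `n ≥ n₀` and rational `0 < ε < 1`: a
single Turing machine, given `n`, `ε`, `i`, `j`, outputs the entry `(i, j)` of `D n ε`, or rejects
if there is no such entry, in time polynomial in the length of its input. -/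
def IsStronglyExplicit (n₀ : ℕ) (m : ℕ → ℚ → ℕ)
    (D : (n : ℕ) → (ε : ℚ) → Matrix (Fin n) (Fin (m n ε)) (ZMod 2)) : Prop :=
  Nonempty (Turing.TM2ComputableInPolyTime (EntryQuery.encode (n₀ := n₀)) encodeAnswer
    fun q : EntryQuery n₀ => entryOrReject (D q.n q.ε) q.i q.j)

/-!
A column of the matrix is a seed `(a, b, r)` of three binary vectors of length `k`, where
`2 n < 2 ^ k ≤ 4 n`. A row index `i`, written as a vector in `𝔽₂ ^ k`, is hashed to `u = A i + b`,
where `A` is the lower triangular Toeplitz matrix with first column `1, a 0, a 1, …`. The level of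
`u` is its length when its leading zeros are dropped, and the entry is the bit of `r` indexed by the
level of `u`, provided that the level is at most `t`, where `2 / ε < 2 ^ t < 8 / ε`; otherwise it is
`0`. There are `2 ^ (3 k) - 1` columns, one for each nonzero seed.

*Weight.* As `A` is invertible, distinct rows have distinct hashes, and only `2 ^ t` hashes have level
at most `t` (`matrixWeight_toeplitzMatrix_le`).

*Distance.* By linearity, the sum of the rows in a set `Z` of `w ≥ ε n` rows has to be nonzero in
`1/16` of the columns. The hash is pairwise independent as far as the windows of the vectors of level
at most `l` are concerned (`le_card_windowSeeds`, `card_windowSeeds_inter_le`). For the `l` with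
`w 2 ^ l / 2 ^ k` between `1/3` and `2/3`, a second moment computation shows that with probability
at least `1/8` over `a` and `b` an odd number of points of `Z` falls into the window
(`card_odd_window`). Then some level has an odd number of points, and its bit of `r` makes the sum
equal to `1` with probability `1/2` (`card_levelCoeff_sum`). The choice of `t` guarantees `l ≤ t`,
and the zero seed contributes nothing, so that it may be left out.

*Explicitness.* The hash is a convolution over `𝔽₂`, which a machine with several stacks computes by
shifting and adding. The number `t` depends only on the bit lengths of the numerator and denominator
of `ε`; `i` is compared with `n` bit by bit, and `j` is in range if and only if it is nonzero and has
at most `3 k` bits. Every phase of the program `prog` has a specification that gives the stacks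
afterwards and a bound on the number of steps; `run_spec` combines them, and `clean_spec` covers the
final emptying of the stacks that the machine model requires.
-/

open Turing Computability

/-! ### A Toeplitz hash over `𝔽₂` -/

/-- The `p`-th output bit of the affine map `x ↦ A x + b`, where `A` is the lower triangular
Toeplitz matrix with first column `a`. -/
def toeplitzBit (a b x : ℕ → ZMod 2) (p : ℕ) : ZMod 2 :=
  b p + ∑ q ∈ Finset.range (p + 1), x q * a (p - q)

/-- The sequence `1, a 0, a 1, …`: with it as first column, the Toeplitz matrix is unitriangular. -/
def consOne (a : ℕ → ZMod 2) : ℕ → ZMod 2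
  | 0 => 1
  | p + 1 => a p

/-- A finite sequence continued by zeros. -/
def extendZero {k : ℕ} (f : Fin k → ZMod 2) (p : ℕ) : ZMod 2 :=
  if h : p < k then f ⟨p, h⟩ else 0

theorem extendZero_of_lt {k : ℕ} (f : Fin k → ZMod 2) {p : ℕ} (h : p < k) :
    extendZero f p = f ⟨p, h⟩ := by
  simp [extendZero, h]

/-- One more than the largest `p < k` with `u p ≠ 0`, or `0` if there is none: the bit length of
the number with the `k` binary digits `u 0, …, u (k - 1)`. -/
def level (u : ℕ → ZMod 2) : ℕ → ℕ
  | 0 => 0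
  | k + 1 => if u k = 0 then level u k else k + 1

theorem level_le_iff (u : ℕ → ZMod 2) (k l : ℕ) :
    level u k ≤ l ↔ ∀ p, l ≤ p → p < k → u p = 0 := by
  induction k with
  | zero => simp [level]
  | succ k ih =>
    unfold level
    split_ifs with h
    · rw [ih]
      constructor
      · intro H p h1 h2
        rcases Nat.lt_succ_iff_lt_or_eq.1 h2 with h3 | rfl
        · exact H p h1 h3
        · exact h
      · exact fun H p h1 h2 => H p h1 (by omega)
    · constructor
      · intro H p h1 h2
        omega
      · intro H
        by_contra hl
        exact h (H k (by omega) (by omega))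

theorem toeplitzBit_eq (a b x : ℕ → ZMod 2) (p : ℕ) :
    toeplitzBit (consOne a) b x p =
      b p + (∑ q ∈ Finset.range p, x q * consOne a (p - q) + x p) := by
  simp [toeplitzBit, Finset.sum_range_succ, consOne]

theorem toeplitzBit_injective {k : ℕ} (a b x y : ℕ → ZMod 2)
    (h : ∀ p < k, toeplitzBit (consOne a) b x p = toeplitzBit (consOne a) b y p) :
    ∀ p < k, x p = y p := by
  intro p
  induction p using Nat.strong_induction_on with
  | _ p ih =>
    intro hp
    have h1 := h p hp
    rw [toeplitzBit_eq, toeplitzBit_eq, Finset.sum_congr rfl (g := fun q => y q * consOne a (p - q))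
      (fun q hq => by rw [ih q (Finset.mem_range.1 hq) ((Finset.mem_range.1 hq).trans hp)])] at h1
    exact add_left_cancel (add_left_cancel h1)

/-- The seeds `(a, b)` whose hash maps `x` into the window of the vectors of level at most `l`. -/
def windowSeeds (k l : ℕ) (x : ℕ → ZMod 2) : Finset ((Fin k → ZMod 2) × (Fin k → ZMod 2)) :=
  Finset.univ.filter fun s =>
    level (toeplitzBit (consOne (extendZero s.1)) (extendZero s.2) x) k ≤ l

theorem mem_windowSeeds {k l : ℕ} {x : ℕ → ZMod 2} {s : (Fin k → ZMod 2) × (Fin k → ZMod 2)} :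
    s ∈ windowSeeds k l x ↔ ∀ p, l ≤ p → p < k →
      toeplitzBit (consOne (extendZero s.1)) (extendZero s.2) x p = 0 := by
  simp [windowSeeds, level_le_iff]

/-- A single point lands in the window with probability at least `2 ^ l / 2 ^ k`: the `a` part and
the first `l` bits of `b` are free, and the remaining bits of `b` can be chosen to match. -/
theorem le_card_windowSeeds {k l : ℕ} (hl : l ≤ k) (x : ℕ → ZMod 2) :
    2 ^ k * 2 ^ l ≤ (windowSeeds k l x).card := by
  classical
  let φ : (Fin k → ZMod 2) × (Fin l → ZMod 2) → (Fin k → ZMod 2) × (Fin k → ZMod 2) := fun s =>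
    (s.1, fun p => if h : (p : ℕ) < l then s.2 ⟨p, h⟩ else
      -∑ q ∈ Finset.range (p + 1), x q * consOne (extendZero s.1) (p - q))
  have hφ : Function.Injective φ := by
    rintro ⟨a, b⟩ ⟨a', b'⟩ h
    simp only [φ, Prod.mk.injEq] at h
    obtain ⟨rfl, h⟩ := h
    congr 1
    funext p
    have := congrFun h ⟨p, p.2.trans_le hl⟩
    simpa using this
  have := Finset.card_le_card_of_injOn (s := Finset.univ) (t := windowSeeds k l x) φ
    (by
      intro s _
      rw [Finset.mem_coe, mem_windowSeeds]
      intro p h1 h2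
      simp only [φ, toeplitzBit, extendZero_of_lt _ h2, Nat.not_lt.2 h1, dif_neg, not_false_iff]
      exact neg_add_cancel _) hφ.injOn
  simpa [ZMod.card] using this

/-- Two distinct points land in the window with probability at most `(2 ^ l / 2 ^ k) ^ 2`. If `v` is
the first position at which they differ, the equations at the positions `p ≥ l` determine the
entries `a (p - v - 1)` and `b p` from the earlier entries of `a`. -/
theorem card_windowSeeds_inter_le {k l : ℕ} {x y : ℕ → ZMod 2}
    (hxy : ∃ p < k, x p ≠ y p) :
    (windowSeeds k l x ∩ windowSeeds k l y).card ≤ 2 ^ l * 2 ^ l := by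
  classical
  obtain ⟨v, ⟨hvk, hv⟩, hmin⟩ : ∃ v, (v < k ∧ x v ≠ y v) ∧ ∀ q < v, x q = y q := by
    refine ⟨Nat.find hxy, Nat.find_spec hxy, fun q hq => ?_⟩
    have h1 := Nat.find_min hxy hq
    have h2 := (Nat.find_spec hxy).1
    by_contra h3
    exact h1 ⟨hq.trans h2, h3⟩
  have hd : x v - y v = 1 := by
    have : ∀ s t : ZMod 2, s ≠ t → s - t = 1 := by decide
    exact this _ _ hv
  have hdiff : ∀ s ∈ windowSeeds k l x ∩ windowSeeds k l y, ∀ c, l ≤ v + c → v + c < k →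
      consOne (extendZero s.1) c =
        -∑ q ∈ Finset.range c, (x (v + (q + 1)) - y (v + (q + 1))) *
          consOne (extendZero s.1) (c - (q + 1)) := by
    intro s hs c h1 h2
    rw [Finset.mem_inter, mem_windowSeeds, mem_windowSeeds] at hs
    have h3 := hs.1 _ h1 h2
    have h4 := hs.2 _ h1 h2
    have h5 : ∑ q ∈ Finset.range (v + c + 1), (x q - y q) *
        consOne (extendZero s.1) (v + c - q) = 0 := by
      simp only [sub_mul, Finset.sum_sub_distrib]
      unfold toeplitzBit at h3 h4
      linear_combination h3 - h4
    rw [show v + c + 1 = v + (c + 1) by ring, Finset.sum_range_add,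
      Finset.sum_eq_zero (fun q hq => by rw [hmin q (Finset.mem_range.1 hq)]; simp),
      Finset.sum_range_succ'] at h5
    simp only [add_zero, hd, Nat.add_sub_cancel_left, one_mul, zero_add, Nat.add_sub_add_left]
      at h5
    linear_combination h5
  by_cases hvl : l ≤ v
  · rw [Finset.card_eq_zero.2]
    · positivity
    · rw [Finset.eq_empty_iff_forall_notMem]
      intro s hs
      have := hdiff s hs 0 hvl hvk
      simp [consOne] at this
  push Not at hvl
  by_cases hlk : k ≤ l
  · refine (Finset.card_le_univ _).trans ?_
    simp only [Fintype.card_prod, Fintype.card_fun, ZMod.card, Fintype.card_fin]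
    gcongr <;> norm_num
  push Not at hlk
  -- the positions of `a` that the equations leave free
  let e : Fin l → Fin k := fun c =>
    ⟨if (c : ℕ) < l - v - 1 then c else c + (k - l), by split_ifs <;> omega⟩
  let φ : (Fin k → ZMod 2) × (Fin k → ZMod 2) → (Fin l → ZMod 2) × (Fin l → ZMod 2) := fun s =>
    (fun c => s.1 (e c), fun c => s.2 ⟨c, c.2.trans hlk⟩)
  have hφ : Set.InjOn φ (windowSeeds k l x ∩ windowSeeds k l y : Finset _) := by
    rintro ⟨a, b⟩ hs ⟨a', b'⟩ hs' h
    rw [Finset.mem_coe] at hs hs'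
    simp only [φ, Prod.mk.injEq] at h
    obtain ⟨h1, h2⟩ := h
    have ha : ∀ c, c ≤ k → consOne (extendZero a) c = consOne (extendZero a') c := by
      intro c
      induction c using Nat.strong_induction_on with
      | _ c ih =>
        intro hc
        by_cases h3 : l ≤ v + c ∧ v + c < k
        · rw [hdiff _ hs c h3.1 h3.2, hdiff _ hs' c h3.1 h3.2]
          congr 1
          refine Finset.sum_congr rfl fun q hq => ?_
          rw [Finset.mem_range] at hq
          rw [ih (c - (q + 1)) (by omega) (by omega)]
        · rcases c with - | c
          · rfl
          · simp only [consOne]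
            rw [extendZero_of_lt _ (by omega), extendZero_of_lt _ (by omega)]
            by_cases h4 : c < l - v - 1
            · have := congrFun h1 ⟨c, by omega⟩
              simpa [e, h4] using this
            · have := congrFun h1 ⟨c - (k - l), by omega⟩
              have h5 : ¬ (c - (k - l) < l - v - 1) := by omega
              have h6 : c - (k - l) + (k - l) = c := by omega
              simpa only [e, h5, h6, if_false] using this
    have haa : a = a' := by
      funext c
      have := ha (c + 1) c.2
      simpa [consOne, extendZero] using this
    subst haa
    congr 1
    funext p
    by_cases hp : (p : ℕ) < l
    · exact congrFun h2 ⟨p, hp⟩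
    · rw [Finset.mem_inter, mem_windowSeeds] at hs hs'
      have h3 := hs.1 p (by omega) p.2
      have h4 := hs'.1 p (by omega) p.2
      simp only [toeplitzBit, extendZero_of_lt _ p.2] at h3 h4
      linear_combination h3 - h4
  have := Finset.card_le_card_of_injOn (t := Finset.univ) φ
    (fun _ _ => Finset.mem_coe.2 (Finset.mem_univ _)) hφ
  simpa [ZMod.card] using this

/-! ### Isolating an odd number of points -/

/-- If the expected number `w 2 ^ l / 2 ^ k` of points of `Z` in the window lies in `[1/3, 2/3]`, an
odd number of points of `Z` lies in the window with probability at least `1/8`. For a number `X`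
of points, `2 X - X ^ 2` is at most `1`, and at most `0` for even `X`; pairwise independence bounds
the expectation of `X ^ 2`. -/
theorem card_odd_window {ι : Type*} [DecidableEq ι] {k l : ℕ} (Z : Finset ι) (x : ι → ℕ → ZMod 2)
    (hx : ∀ i ∈ Z, ∀ j ∈ Z, i ≠ j → ∃ p < k, x i p ≠ x j p) (hl : l ≤ k)
    (h1 : 2 ^ k ≤ 3 * (Z.card * 2 ^ l)) (h2 : 3 * (Z.card * 2 ^ l) ≤ 2 * 2 ^ k) :
    2 ^ k * 2 ^ k ≤ 8 * (Finset.univ.filter fun s : (Fin k → ZMod 2) × (Fin k → ZMod 2) =>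
      Odd (Z.filter fun i => s ∈ windowSeeds k l (x i)).card).card := by
  set X : (Fin k → ZMod 2) × (Fin k → ZMod 2) → ℕ := fun s =>
    (Z.filter fun i => s ∈ windowSeeds k l (x i)).card with hX
  have hX1 : ∀ s, (X s : ℤ) = ∑ i ∈ Z, if s ∈ windowSeeds k l (x i) then 1 else 0 := by
    intro s
    simp [hX]
  have hsum : ∑ s, (X s : ℤ) = ∑ i ∈ Z, ((windowSeeds k l (x i)).card : ℤ) := by
    simp only [hX1]
    rw [Finset.sum_comm]
    simp
  have hsq : ∑ s, (X s : ℤ) ^ 2 =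
      ∑ i ∈ Z, ∑ j ∈ Z, ((windowSeeds k l (x i) ∩ windowSeeds k l (x j)).card : ℤ) := by
    simp only [hX1, sq, Finset.sum_mul_sum]
    rw [Finset.sum_comm]
    refine Finset.sum_congr rfl fun i _ => ?_
    rw [Finset.sum_comm]
    refine Finset.sum_congr rfl fun j _ => ?_
    simp only [← ite_and, mul_ite, mul_one, mul_zero, ← Finset.mem_inter, Finset.inter_comm]
    simp only [Finset.sum_boole, Nat.cast_inj]
    congr 1
    ext
    simp
  have hsq' : ∑ s, (X s : ℤ) ^ 2 ≤ ∑ s, (X s : ℤ) + (Z.card * 2 ^ l) ^ 2 := by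
    rw [hsq, hsum]
    calc _ ≤ ∑ i ∈ Z, (((windowSeeds k l (x i)).card : ℤ) + ∑ j ∈ Z, (2 ^ l * 2 ^ l : ℤ)) := by
          refine Finset.sum_le_sum fun i hi => ?_
          rw [← Finset.add_sum_erase _ _ hi, Finset.inter_self]
          gcongr
          refine (Finset.sum_le_sum fun j hj => ?_).trans
            (Finset.sum_le_sum_of_subset_of_nonneg (Finset.erase_subset i Z)
              fun _ _ _ => by positivity)
          rw [Finset.mem_erase] at hj
          exact_mod_cast card_windowSeeds_inter_le (hx i hi j hj.2 hj.1.symm)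
      _ = _ := by
          rw [Finset.sum_add_distrib]
          simp
          ring
  have hlow : (2 ^ k * (Z.card * 2 ^ l) : ℤ) ≤ ∑ s, (X s : ℤ) := by
    rw [hsum]
    calc (2 ^ k * (Z.card * 2 ^ l) : ℤ) = ∑ i ∈ Z, (2 ^ k * 2 ^ l : ℤ) := by simp; ring
      _ ≤ _ := Finset.sum_le_sum fun i _ => by exact_mod_cast le_card_windowSeeds hl (x i)
  have hodd : ∑ s, (2 * (X s : ℤ) - (X s : ℤ) ^ 2) ≤
      ((Finset.univ.filter fun s => Odd (X s)).card : ℤ) := by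
    rw [Finset.card_filter]
    push_cast
    refine Finset.sum_le_sum fun s _ => ?_
    split_ifs with h
    · nlinarith [sq_nonneg ((X s : ℤ) - 1)]
    · rw [Nat.not_odd_iff_even] at h
      obtain ⟨c, hc⟩ := h
      rcases c with - | c
      · simp [hc]
      · rw [hc]
        push_cast
        nlinarith
  rw [Finset.sum_sub_distrib, ← Finset.mul_sum] at hodd
  have h1' : (2 ^ k : ℤ) ≤ 3 * (Z.card * 2 ^ l) := by exact_mod_cast h1
  have h2' : 3 * (Z.card * 2 ^ l) ≤ (2 * 2 ^ k : ℤ) := by exact_mod_cast h2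
  have : (2 ^ k * 2 ^ k : ℤ) ≤ 8 * ((Finset.univ.filter fun s => Odd (X s)).card : ℤ) := by
    generalize (Z.card * 2 ^ l : ℤ) = y at *
    generalize (2 ^ k : ℤ) = N at *
    nlinarith [mul_nonneg (sub_nonneg.2 h1') (sub_nonneg.2 h2'), sq_nonneg N]
  exact_mod_cast this

/-- The coefficient with which a point of level `l` enters the column with level bits `r`. -/
def levelCoeff (k t : ℕ) (r : ℕ → ZMod 2) (l : ℕ) : ZMod 2 :=
  if l < k ∧ l ≤ t then r l else 0

/-- If an odd number of points has level at most `l`, then some level `≤ l` has an odd number of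
points, so that flipping its bit of `r` flips the sum of the coefficients. -/
theorem card_levelCoeff_sum {ι : Type*} {k l t : ℕ} (Z : Finset ι) (lev : ι → ℕ)
    (hlk : l < k) (hlt : l ≤ t) (h : Odd (Z.filter fun i => lev i ≤ l).card) :
    2 ^ k ≤ 2 * (Finset.univ.filter fun r : Fin k → ZMod 2 =>
      ∑ i ∈ Z, levelCoeff k t (extendZero r) (lev i) ≠ 0).card := by
  classical
  obtain ⟨c, hc, hodd⟩ : ∃ c ≤ l, Odd (Z.filter fun i => lev i = c).card := by
    by_contra! H
    refine (Nat.not_odd_iff_even.2 ?_) h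
    rw [Finset.card_eq_sum_card_fiberwise (f := lev) (t := Finset.range (l + 1))
      (fun i hi => by simpa [Nat.lt_succ_iff] using (Finset.mem_filter.1 hi).2)]
    refine Finset.even_sum _ fun c hc => ?_
    have hc' : c ≤ l := Nat.lt_succ_iff.1 (Finset.mem_range.1 hc)
    have := H c hc'
    rw [Nat.not_odd_iff_even] at this
    rwa [Finset.filter_filter, Finset.filter_congr (q := fun i => lev i = c)
      fun i _ => ⟨fun h => h.2, fun h => ⟨h.trans_le hc', h⟩⟩]
  have hck : c < k := hc.trans_lt hlk
  set F : (Fin k → ZMod 2) → ZMod 2 := fun r =>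
    ∑ i ∈ Z, levelCoeff k t (extendZero r) (lev i) with hF
  have hflip : ∀ r, F (r + Pi.single ⟨c, hck⟩ 1) = F r + 1 := by
    intro r
    have h1 : ∀ i, levelCoeff k t (extendZero (r + Pi.single ⟨c, hck⟩ 1)) (lev i) =
        levelCoeff k t (extendZero r) (lev i) + if lev i = c then 1 else 0 := by
      intro i
      unfold levelCoeff
      by_cases h2 : lev i = c
      · simp [h2, hck, hc.trans hlt, extendZero]
      · by_cases h3 : lev i < k
        · simp [h2, h3, extendZero]
        · simp [h2, h3]
    simp only [hF, h1, Finset.sum_add_distrib, Finset.sum_boole]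
    rw [ZMod.natCast_eq_one_iff_odd.2 hodd]
  have h2 : (Finset.univ.filter fun r => ¬ F r ≠ 0).card ≤
      (Finset.univ.filter fun r => F r ≠ 0).card := by
    refine Finset.card_le_card_of_injOn (fun r => r + Pi.single ⟨c, hck⟩ 1) ?_
      (fun _ _ _ _ h => add_right_cancel h)
    intro r hr
    have h3 : F r = 0 := by simpa using hr
    simp [hflip, h3]
  have h3 := Finset.card_filter_add_card_filter_not (s := Finset.univ) (fun r => F r ≠ 0)
  simp only [Finset.card_univ, Fintype.card_fun, ZMod.card, Fintype.card_fin] at h3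
  change 2 ^ k ≤ 2 * (Finset.univ.filter fun r => F r ≠ 0).card
  omega

/-- The two previous counts combined: the seeds for which the points of `Z` sum to `1`. -/
theorem card_good_seeds {ι : Type*} [DecidableEq ι] {k l t : ℕ} (Z : Finset ι)
    (x : ι → ℕ → ZMod 2)
    (hx : ∀ i ∈ Z, ∀ j ∈ Z, i ≠ j → ∃ p < k, x i p ≠ x j p) (hlk : l < k) (hlt : l ≤ t)
    (h1 : 2 ^ k ≤ 3 * (Z.card * 2 ^ l)) (h2 : 3 * (Z.card * 2 ^ l) ≤ 2 * 2 ^ k) :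
    2 ^ (3 * k) ≤ 16 * (Finset.univ.filter
      fun s : ((Fin k → ZMod 2) × (Fin k → ZMod 2)) × (Fin k → ZMod 2) =>
        ∑ i ∈ Z, levelCoeff k t (extendZero s.2) (level (toeplitzBit
          (consOne (extendZero s.1.1)) (extendZero s.1.2) (x i)) k) ≠ 0).card := by
  have hodd := card_odd_window Z x hx hlk.le h1 h2
  rw [Finset.card_filter, Fintype.sum_prod_type]
  have h3 : ∀ s ∈ Finset.univ.filter (fun s : (Fin k → ZMod 2) × (Fin k → ZMod 2) =>
      Odd (Z.filter fun i => s ∈ windowSeeds k l (x i)).card),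
      2 ^ k ≤ 2 * ∑ r : Fin k → ZMod 2, if ∑ i ∈ Z, levelCoeff k t (extendZero r)
        (level (toeplitzBit (consOne (extendZero s.1)) (extendZero s.2) (x i)) k) ≠ 0
          then 1 else 0 := by
    intro s hs
    rw [← Finset.card_filter]
    refine card_levelCoeff_sum Z _ hlk hlt ?_
    simpa [windowSeeds] using hs
  have h4 := Finset.card_nsmul_le_sum _ _ _ h3
  rw [← Finset.mul_sum, smul_eq_mul] at h4
  have h5 := Finset.sum_le_sum_of_subset (f := fun s : (Fin k → ZMod 2) × (Fin k → ZMod 2) =>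
    ∑ r : Fin k → ZMod 2, if ∑ i ∈ Z, levelCoeff k t (extendZero r)
        (level (toeplitzBit (consOne (extendZero s.1)) (extendZero s.2) (x i)) k) ≠ 0
          then 1 else 0) (Finset.filter_subset (fun s : (Fin k → ZMod 2) × (Fin k → ZMod 2) =>
      Odd (Z.filter fun i => s ∈ windowSeeds k l (x i)).card) Finset.univ)
  rw [show 3 * k = k + k + k by ring, pow_add, pow_add]
  calc 2 ^ k * 2 ^ k * 2 ^ k ≤ 8 * _ * 2 ^ k := Nat.mul_le_mul_right _ hodd
    _ ≤ 16 * _ := by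
      rw [mul_assoc, show 16 = 8 * 2 by rfl, mul_assoc 8 2]
      exact Nat.mul_le_mul_left 8 (h4.trans (Nat.mul_le_mul_left 2 h5))

/-! ### The matrices -/

/-- A bit as an element of `𝔽₂`. -/
def bitVal (b : Bool) : ZMod 2 := if b then 1 else 0

/-- The first part of the seed `j`: the bits at the positions divisible by `3`, the most significant
one first. -/
def seedA (k j c : ℕ) : ZMod 2 := if c < k then bitVal (j.testBit (3 * (k - 1 - c))) else 0

/-- The second part of the seed `j`: the bits at the positions `≡ 1 (mod 3)`, the most significant
one first. -/
def seedB (k j c : ℕ) : ZMod 2 := if c < k then bitVal (j.testBit (3 * (k - 1 - c) + 1)) else 0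

/-- The third part of the seed `j`: the bits at the positions `≡ 2 (mod 3)`, the least significant
one first. -/
def seedR (k j c : ℕ) : ZMod 2 := if c < k then bitVal (j.testBit (3 * c + 2)) else 0

/-- The `k` lowest bits of `i`, the most significant one first. -/
def pointBits (k i p : ℕ) : ZMod 2 := bitVal (i.testBit (k - 1 - p))

/-- The entry in row `i` and column `j`: the point `i` is hashed with the first two parts of `j`, and
the level of its hash selects a bit of the third part. -/
def toeplitzEntry (k t i j : ℕ) : ZMod 2 :=
  levelCoeff k t (seedR k j)
    (level (toeplitzBit (consOne (seedA k j)) (seedB k j) (pointBits k i)) k)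

/-- The number of bits of a row index, chosen so that `2 n < 2 ^ k ≤ 4 n` when `n > 0`. -/
def rowBits (n : ℕ) : ℕ := n.size + 1

/-- The largest level that contributes, chosen so that `2 / ε < 2 ^ t < 8 / ε` when
`0 < ε < 1`. -/
def maxLevel (ε : ℚ) : ℕ := ε.den.size - ε.num.natAbs.size + 2

/-- The number of columns: one for each nonzero seed. -/
def numCols (n : ℕ) : ℕ := 2 ^ (3 * rowBits n) - 1

/-- The distinguisher, with rows and columns numbered from `1`. -/
def toeplitzMatrix (n : ℕ) (ε : ℚ) : Matrix (Fin n) (Fin (numCols n)) (ZMod 2) :=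
  Matrix.of fun i j => toeplitzEntry (rowBits n) (maxLevel ε) (i + 1) (j + 1)

theorem bitVal_injective : Function.Injective bitVal := by
  unfold bitVal
  decide

theorem bitVal_decide (x : ZMod 2) : bitVal (decide (x = 1)) = x := by
  unfold bitVal
  revert x
  decide

theorem exists_pointBits_ne {k i j : ℕ} (hi : i < 2 ^ k) (hj : j < 2 ^ k) (h : i ≠ j) :
    ∃ p < k, pointBits k i p ≠ pointBits k j p := by
  by_contra! H
  refine h (Nat.eq_of_testBit_eq fun p => ?_)
  rcases lt_or_ge p k with hp | hp
  · have := bitVal_injective (H (k - 1 - p) (by omega))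
    rwa [show k - 1 - (k - 1 - p) = p by omega] at this
  · rw [Nat.testBit_lt_two_pow (hi.trans_le (Nat.pow_le_pow_right (by norm_num) hp)),
      Nat.testBit_lt_two_pow (hj.trans_le (Nat.pow_le_pow_right (by norm_num) hp))]

/-- The number with given parts as a seed. -/
def seedNat {k : ℕ} (s : ((Fin k → ZMod 2) × (Fin k → ZMod 2)) × (Fin k → ZMod 2)) : ℕ :=
  Nat.ofBits fun q : Fin (3 * k) => decide
    ((if (q : ℕ) % 3 = 0 then extendZero s.1.1 (k - 1 - q / 3)
      else if (q : ℕ) % 3 = 1 then extendZero s.1.2 (k - 1 - q / 3)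
      else extendZero s.2 (q / 3)) = 1)

section
variable {k : ℕ} (s : ((Fin k → ZMod 2) × (Fin k → ZMod 2)) × (Fin k → ZMod 2))

theorem seedA_seedNat : seedA k (seedNat s) = extendZero s.1.1 := by
  funext c
  unfold seedA
  split_ifs with h
  · rw [seedNat, Nat.testBit_ofBits_lt _ _ (by omega), bitVal_decide, if_pos (by simp)]
    congr 1
    simp only
    omega
  · simp [extendZero, h]

theorem seedB_seedNat : seedB k (seedNat s) = extendZero s.1.2 := by
  funext c
  unfold seedB
  split_ifs with h
  · rw [seedNat, Nat.testBit_ofBits_lt _ _ (by omega), bitVal_decide, if_neg (by simp),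
      if_pos (by simp)]
    congr 1
    simp only
    omega
  · simp [extendZero, h]

theorem seedR_seedNat : seedR k (seedNat s) = extendZero s.2 := by
  funext c
  unfold seedR
  split_ifs with h
  · rw [seedNat, Nat.testBit_ofBits_lt _ _ (by omega), bitVal_decide, if_neg (by simp),
      if_neg (by simp)]
    congr 1
    simp only
    omega
  · simp [extendZero, h]

end

theorem extendZero_injective {k : ℕ} :
    Function.Injective (extendZero : (Fin k → ZMod 2) → ℕ → ZMod 2) := by
  intro f g h
  funext p
  have := congrFun h p
  simpa [extendZero] using this

theorem seedNat_injective {k : ℕ} : Function.Injective (seedNat (k := k)) := by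
  intro s s' h
  have h1 := seedA_seedNat s
  have h2 := seedB_seedNat s
  have h3 := seedR_seedNat s
  rw [h] at h1 h2 h3
  rw [seedA_seedNat] at h1
  rw [seedB_seedNat] at h2
  rw [seedR_seedNat] at h3
  exact Prod.ext (Prod.ext (extendZero_injective h1.symm) (extendZero_injective h2.symm))
    (extendZero_injective h3.symm)

theorem toeplitzEntry_zero_right (k t i : ℕ) : toeplitzEntry k t i 0 = 0 := by
  simp [toeplitzEntry, levelCoeff, seedR, bitVal]

theorem two_mul_lt_two_pow_rowBits (n : ℕ) : 2 * n < 2 ^ rowBits n := by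
  have := Nat.lt_size_self n
  rw [rowBits, pow_succ]
  omega

theorem two_pow_size_le {n : ℕ} (hn : 0 < n) : 2 ^ n.size ≤ 2 * n := by
  have h1 := Nat.size_pos.2 hn
  have h2 := Nat.lt_size.1 (show n.size - 1 < n.size by omega)
  rw [show n.size = n.size - 1 + 1 by omega, pow_succ]
  omega

theorem two_pow_rowBits_le {n : ℕ} (hn : 0 < n) : 2 ^ rowBits n ≤ 4 * n := by
  have := two_pow_size_le hn
  rw [rowBits, pow_succ]
  omega

/-- Since the hash is injective in the point, at most `2 ^ t` points have level at most `t`. -/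
theorem matrixWeight_toeplitzMatrix_le (n : ℕ) (ε : ℚ) :
    matrixWeight (toeplitzMatrix n ε) ≤ 2 ^ maxLevel ε := by
  refine Finset.sup_le fun j _ => ?_
  set t := maxLevel ε
  set k := rowBits n
  set u : Fin n → ℕ → ZMod 2 := fun i => toeplitzBit (consOne (seedA k (j + 1))) (seedB k (j + 1))
    (pointBits k (i + 1)) with hu
  have hlt : ∀ i : Fin n, (i : ℕ) + 1 < 2 ^ k := fun i => by
    have : 2 * n < 2 ^ k := two_mul_lt_two_pow_rowBits n
    omega
  have key := Finset.card_le_card_of_injOn (t := Finset.univ)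
    (s := Finset.univ.filter fun i : Fin n => toeplitzMatrix n ε i j ≠ 0)
    (fun i => fun p : Fin t => u i p) (fun _ _ => Finset.mem_coe.2 (Finset.mem_univ _)) (by
      intro i hi i' hi' h
      have hlev : ∀ i : Fin n, toeplitzMatrix n ε i j ≠ 0 → level (u i) k ≤ t := by
        intro i hi
        by_contra hc
        exact hi (if_neg fun h => hc h.2)
      have hz := (level_le_iff _ _ _).1 (hlev i (by simpa using hi))
      have hz' := (level_le_iff _ _ _).1 (hlev i' (by simpa using hi'))
      have heq := toeplitzBit_injective (k := k) (seedA k (j + 1)) (seedB k (j + 1))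
        (pointBits k (i + 1)) (pointBits k (i' + 1)) (by
          intro p hp
          rcases lt_or_ge p t with hpt | hpt
          · exact congrFun h ⟨p, hpt⟩
          · exact (hz p hpt hp).trans (hz' p hpt hp).symm)
      by_contra hne
      obtain ⟨p, hp, hpne⟩ := exists_pointBits_ne (hlt i) (hlt i')
        (fun h => hne (Fin.ext (by omega)))
      exact hpne (heq p hp))
  rw [Finset.card_univ, Fintype.card_fun, ZMod.card, Fintype.card_fin] at key
  exact key

theorem natAbs_num_pos {ε : ℚ} (h0 : 0 < ε) : 0 < ε.num.natAbs := by
  have := Rat.num_pos.2 h0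
  omega

theorem cast_eq_natAbs_div {ε : ℚ} (h0 : 0 < ε) : (ε : ℝ) = ε.num.natAbs / ε.den := by
  have h : ((ε.num.natAbs : ℤ) : ℝ) = ε.num := by
    rw [Int.natAbs_of_nonneg (Rat.num_pos.2 h0).le]
  rw [Int.cast_natCast] at h
  rw [h]
  exact Rat.cast_def ε

theorem natAbs_num_lt_den {ε : ℚ} (h0 : 0 < ε) (h1 : ε < 1) : ε.num.natAbs < ε.den := by
  have h2 := Rat.num_pos.2 h0
  have h3 := Rat.num_lt_denom_iff.2 h1
  omega

theorem size_num_add {ε : ℚ} (h0 : 0 < ε) (h1 : ε < 1) :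
    ε.num.natAbs.size + maxLevel ε = ε.den.size + 2 := by
  have := Nat.size_le_size (natAbs_num_lt_den h0 h1).le
  unfold maxLevel
  omega

theorem num_mul_two_pow_maxLevel_le {ε : ℚ} (h0 : 0 < ε) (h1 : ε < 1) : ε.num.natAbs * 2 ^ maxLevel ε ≤ 8 * ε.den := by
  calc ε.num.natAbs * 2 ^ maxLevel ε ≤ 2 ^ ε.num.natAbs.size * 2 ^ maxLevel ε :=
        Nat.mul_le_mul_right _ (Nat.lt_size_self _).le
    _ = 4 * 2 ^ ε.den.size := by rw [← pow_add, size_num_add h0 h1, pow_add]; ring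
    _ ≤ 8 * ε.den := by
        have := two_pow_size_le ε.den_pos
        omega

theorem lt_num_mul_two_pow_maxLevel {ε : ℚ} (h0 : 0 < ε) (h1 : ε < 1) : 2 * ε.den < ε.num.natAbs * 2 ^ maxLevel ε := by
  have h := Nat.lt_size_self ε.den
  have h2 := two_pow_size_le (natAbs_num_pos h0)
  have h3 : 2 ^ ε.num.natAbs.size * 2 ^ maxLevel ε = 4 * 2 ^ ε.den.size := by
    rw [← pow_add, size_num_add h0 h1, pow_add]; ring
  have h4 := Nat.mul_le_mul_right (2 ^ maxLevel ε) h2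
  nlinarith

theorem isDistinguisher_toeplitzMatrix {n : ℕ} (hn : 0 < n) {ε : ℚ} (h0 : 0 < ε) (h1 : ε < 1) :
    IsDistinguisher (1 / 16 : ℝ) (ε : ℝ) (toeplitzMatrix n ε) := by
  intro x y hxy
  rw [hammingDist_eq_hammingNorm (Matrix.vecMul x _), ← Matrix.neg_vecMul,
    ← Matrix.add_vecMul]
  set k := rowBits n with hk
  set t := maxLevel ε with ht
  set Z : Finset (Fin n) := Finset.univ.filter fun i => x i ≠ y i with hZ
  change (ε : ℝ) * n ≤ (Z.card : ℝ) at hxy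
  have hN1 := two_mul_lt_two_pow_rowBits n
  have hN2 := two_pow_rowBits_le hn
  rw [← hk] at hN1 hN2
  have hwn : Z.card ≤ n := by simpa using Finset.card_le_univ Z
  have hw : ε.num.natAbs * n ≤ Z.card * ε.den := by
    rw [cast_eq_natAbs_div h0, div_mul_eq_mul_div, div_le_iff₀ (by exact_mod_cast ε.den_pos)] at hxy
    exact_mod_cast hxy
  have hw0 : 0 < Z.card := by
    have := Nat.mul_pos (natAbs_num_pos h0) hn
    by_contra hc
    simp only [not_lt, Nat.le_zero] at hc
    rw [hc] at hw
    omega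
  -- the window is the smallest one whose expected number of points is at least `1 / 3`
  obtain ⟨l, hl1, hl2, hlt⟩ : ∃ l, 2 ^ k ≤ 3 * (Z.card * 2 ^ l) ∧
      3 * (Z.card * 2 ^ l) ≤ 2 * 2 ^ k ∧ l ≤ t := by
    have hex : ∃ l, 2 ^ k ≤ 3 * (Z.card * 2 ^ l) := ⟨k, by nlinarith [Nat.two_pow_pos k]⟩
    refine ⟨Nat.find hex, Nat.find_spec hex, ?_, ?_⟩
    · rcases h : Nat.find hex with - | l
      · omega
      · have := Nat.find_min hex (show l < Nat.find hex by omega)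
        have : Z.card * 2 ^ (l + 1) = Z.card * 2 ^ l * 2 := by ring
        omega
    · refine Nat.find_min' hex ?_
      have h2 := lt_num_mul_two_pow_maxLevel h0 h1
      rw [← ht] at h2
      have h3 : 2 * ε.den * n ≤ Z.card * 2 ^ t * ε.den := by
        calc 2 * ε.den * n ≤ ε.num.natAbs * 2 ^ t * n := Nat.mul_le_mul_right _ h2.le
          _ = ε.num.natAbs * n * 2 ^ t := by ring
          _ ≤ Z.card * ε.den * 2 ^ t := Nat.mul_le_mul_right _ hw
          _ = _ := by ring
      have h4 : 2 * n ≤ Z.card * 2 ^ t :=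
        Nat.le_of_mul_le_mul_right (by linarith) ε.den_pos
      omega
  have hlk : l < k := by
    have h2 : 2 ^ l < 2 ^ k := by
      have : 2 ^ l ≤ Z.card * 2 ^ l := Nat.le_mul_of_pos_left _ hw0
      have := Nat.two_pow_pos l
      omega
    exact (Nat.pow_lt_pow_iff_right (by norm_num)).1 h2
  have hcount := card_good_seeds (k := k) (l := l) (t := t) Z
    (fun i : Fin n => pointBits k (i + 1))
    (fun i _ j _ hij => exists_pointBits_ne (by omega) (by omega)
      (fun h => hij (Fin.ext (by omega)))) hlk hlt hl1 hl2
  set G := Finset.univ.filter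
      fun s : ((Fin k → ZMod 2) × (Fin k → ZMod 2)) × (Fin k → ZMod 2) =>
        ∑ i ∈ Z, levelCoeff k t (extendZero s.2) (level (toeplitzBit
          (consOne (extendZero s.1.1)) (extendZero s.1.2) (pointBits k (i + 1))) k) ≠ 0 with hG
  have hGe : ∀ s ∈ G, ∑ i ∈ Z, toeplitzEntry k t (i + 1) (seedNat s) ≠ 0 := by
    intro s hs
    simpa [toeplitzEntry, hG, seedA_seedNat, seedB_seedNat, seedR_seedNat] using hs
  have hpos : ∀ s ∈ G, 0 < seedNat s := by
    intro s hs
    rw [Nat.pos_iff_ne_zero]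
    intro h
    refine hGe s hs ?_
    simp [h, toeplitzEntry_zero_right]
  have hvec : ∀ j, Matrix.vecMul (-x + y) (toeplitzMatrix n ε) j =
      ∑ i ∈ Z, toeplitzEntry k t (i + 1) (j + 1) := by
    intro j
    rw [hZ, Finset.sum_filter]
    simp only [Matrix.vecMul, dotProduct]
    refine Finset.sum_congr rfl fun i _ => ?_
    have : ∀ s t : ZMod 2, -s + t = if s ≠ t then 1 else 0 := by decide
    simp only [Pi.add_apply, Pi.neg_apply, this (x i), ite_mul, one_mul, zero_mul]
    rfl
  have hnorm : G.card ≤ hammingNorm (Matrix.vecMul (-x + y) (toeplitzMatrix n ε)) := by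
    refine Finset.card_le_card_of_injOn
      (fun s => if h : seedNat s - 1 < numCols n then ⟨seedNat s - 1, h⟩ else
        ⟨0, by have := Nat.one_lt_two_pow (n := 3 * rowBits n) (by unfold rowBits; omega)
               unfold numCols; omega⟩) ?_ ?_
    all_goals
      have hlt : ∀ s ∈ G, seedNat s - 1 < numCols n := by
        intro s hs
        have h2 := hpos s hs
        have h3 : seedNat s < 2 ^ (3 * k) := Nat.ofBits_lt_two_pow _
        change seedNat s - 1 < 2 ^ (3 * k) - 1
        omega
    · intro s hs
      have h2 := hpos s hs
      rw [Finset.mem_coe] at hs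
      simp only [dif_pos (hlt s hs), Finset.coe_filter, Finset.mem_univ, true_and, Set.mem_ofPred_eq]
      rw [hvec]
      simp only [Nat.sub_add_cancel h2]
      exact hGe s hs
    · intro s hs s' hs' h
      have h2 := hpos s hs
      have h3 := hpos s' hs'
      simp only [dif_pos (hlt s hs), dif_pos (hlt s' hs'), Fin.mk.injEq] at h
      exact seedNat_injective (by omega)
  have hfin : numCols n ≤ 16 * hammingNorm (Matrix.vecMul (-x + y) (toeplitzMatrix n ε)) := by
    change 2 ^ (3 * k) - 1 ≤ _
    exact (show 2 ^ (3 * k) - 1 ≤ 16 * G.card by omega).trans (Nat.mul_le_mul_left 16 hnorm)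
  have : (numCols n : ℝ) ≤ 16 * (hammingNorm (Matrix.vecMul (-x + y) (toeplitzMatrix n ε)) : ℝ) := by
    exact_mod_cast hfin
  linarith

theorem numCols_pos (n : ℕ) : 0 < numCols n := by
  have := Nat.one_lt_two_pow (n := 3 * rowBits n) (by unfold rowBits; omega)
  unfold numCols
  omega

theorem numCols_le {n : ℕ} (hn : 2 ≤ n) : numCols n ≤ n ^ 11 := by
  calc numCols n ≤ (2 ^ rowBits n) ^ 3 := by rw [numCols, mul_comm, pow_mul]; omega
    _ ≤ (4 * n) ^ 3 := Nat.pow_le_pow_left (two_pow_rowBits_le (by omega)) 3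
    _ ≤ (n ^ 2 * n) ^ 3 := by gcongr; nlinarith
    _ = n ^ 9 := by ring
    _ ≤ n ^ 11 := Nat.pow_le_pow_right (by omega) (by norm_num)

theorem matrixWeight_toeplitzMatrix_le_logb {n : ℕ} (hn : 1 ≤ n) {ε : ℚ} (h0 : 0 < ε)
    (h1 : ε < 1) :
    (matrixWeight (toeplitzMatrix n ε) : ℝ) ≤ 8 * Real.logb 2 (2 * (n : ℝ)) / (ε : ℝ) := by
  have hlog : 1 ≤ Real.logb 2 (2 * (n : ℝ)) := by
    rw [Real.le_logb_iff_rpow_le (by norm_num) (by positivity), Real.rpow_one]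
    have : (1 : ℝ) ≤ n := by exact_mod_cast hn
    linarith
  have hε : (0 : ℝ) < ε := by exact_mod_cast h0
  have h2 : ((ε.num.natAbs * 2 ^ maxLevel ε : ℕ) : ℝ) ≤ (8 * ε.den : ℕ) := by
    exact_mod_cast num_mul_two_pow_maxLevel_le h0 h1
  have h3 : (matrixWeight (toeplitzMatrix n ε) : ℝ) ≤ 2 ^ maxLevel ε := by
    exact_mod_cast matrixWeight_toeplitzMatrix_le n ε
  have h4 : (0 : ℝ) < ε.den := by exact_mod_cast ε.den_pos
  rw [le_div_iff₀ hε]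
  calc (matrixWeight (toeplitzMatrix n ε) : ℝ) * ε ≤ 2 ^ maxLevel ε * ε := by gcongr
    _ ≤ 8 := by
      rw [cast_eq_natAbs_div h0, mul_div_assoc', div_le_iff₀ h4]
      push_cast at h2
      linarith
    _ ≤ 8 * Real.logb 2 (2 * (n : ℝ)) := by linarith

/-! ### The machine -/


/-- The stacks of the machine. -/
inductive Stk
  | inp | nn | mm | pp | ss | ii | aa | bb | rr | ca | cb | uu | out
  deriving DecidableEq

instance : Fintype Stk where
  elems := {.inp, .nn, .mm, .pp, .ss, .ii, .aa, .bb, .rr, .ca, .cb, .uu, .out}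
  complete k := by cases k <;> decide

/-- The alphabets: the input stack holds the input symbols, the others hold bits. -/
abbrev StkAlphabet : Stk → Type
  | .inp => Γ'
  | _ => Bool

/-- The contents of all stacks, the top of each stack first. -/
structure Tapes where
  inp : List Γ' := []
  nn : List Bool := []
  mm : List Bool := []
  pp : List Bool := []
  ss : List Bool := []
  ii : List Bool := []
  aa : List Bool := []
  bb : List Bool := []
  rr : List Bool := []
  ca : List Bool := []
  cb : List Bool := []
  uu : List Bool := []
  out : List Bool := []

/-- The contents as the dependent function used by the machine model. -/
@[simp] def Tapes.stk (T : Tapes) : ∀ k, List (StkAlphabet k)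
  | .inp => T.inp
  | .nn => T.nn
  | .mm => T.mm
  | .pp => T.pp
  | .ss => T.ss
  | .ii => T.ii
  | .aa => T.aa
  | .bb => T.bb
  | .rr => T.rr
  | .ca => T.ca
  | .cb => T.cb
  | .uu => T.uu
  | .out => T.out

section
variable (T : Tapes) (l : List Bool)

@[simp] theorem update_stk_inp (l : List Γ') :
    Function.update T.stk .inp l = ({ T with inp := l } : Tapes).stk := by
  funext k; cases k <;> rfl
@[simp] theorem update_stk_nn : Function.update T.stk .nn l = ({ T with nn := l } : Tapes).stk := by
  funext k; cases k <;> rfl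
@[simp] theorem update_stk_mm : Function.update T.stk .mm l = ({ T with mm := l } : Tapes).stk := by
  funext k; cases k <;> rfl
@[simp] theorem update_stk_pp : Function.update T.stk .pp l = ({ T with pp := l } : Tapes).stk := by
  funext k; cases k <;> rfl
@[simp] theorem update_stk_ss : Function.update T.stk .ss l = ({ T with ss := l } : Tapes).stk := by
  funext k; cases k <;> rfl
@[simp] theorem update_stk_ii : Function.update T.stk .ii l = ({ T with ii := l } : Tapes).stk := by
  funext k; cases k <;> rfl
@[simp] theorem update_stk_aa : Function.update T.stk .aa l = ({ T with aa := l } : Tapes).stk := by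
  funext k; cases k <;> rfl
@[simp] theorem update_stk_bb : Function.update T.stk .bb l = ({ T with bb := l } : Tapes).stk := by
  funext k; cases k <;> rfl
@[simp] theorem update_stk_rr : Function.update T.stk .rr l = ({ T with rr := l } : Tapes).stk := by
  funext k; cases k <;> rfl
@[simp] theorem update_stk_ca : Function.update T.stk .ca l = ({ T with ca := l } : Tapes).stk := by
  funext k; cases k <;> rfl
@[simp] theorem update_stk_cb : Function.update T.stk .cb l = ({ T with cb := l } : Tapes).stk := by
  funext k; cases k <;> rfl
@[simp] theorem update_stk_uu : Function.update T.stk .uu l = ({ T with uu := l } : Tapes).stk := by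
  funext k; cases k <;> rfl
@[simp] theorem update_stk_out : Function.update T.stk .out l = ({ T with out := l } : Tapes).stk := by
  funext k; cases k <;> rfl

end

/-- The registers: the last input symbol `c`, three popped bits, a flag and the answer. -/
structure Reg where
  c : Option Γ' := none
  x : Option Bool := none
  y : Option Bool := none
  z : Option Bool := none
  f : Bool := false
  ans : Option Bool := none

noncomputable instance : Fintype Reg :=
  Fintype.ofInjective (β := Option Γ' × Option Bool × Option Bool × Option Bool × Bool × Option Bool)
    (fun v => (v.c, v.x, v.y, v.z, v.f, v.ans)) (by
      rintro ⟨⟩ ⟨⟩ h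
      simpa using h)

/-- The labels of the program. -/
inductive Lbl
  | readN | readP | readQ | flip | readI | readJ | outer | inner | restore | scan | check | clean
  deriving DecidableEq

instance : Fintype Lbl where
  elems := {.readN, .readP, .readQ, .flip, .readI, .readJ, .outer, .inner, .restore, .scan, .check,
    .clean}
  complete l := by cases l <;> decide

/-- Whether an input symbol is a bit, rather than a comma or the end of the input. -/
def isBit : Option Γ' → Bool
  | some (.bit _) => true
  | _ => false

/-- The bit on the input, read as `0` if there is none. -/
def bitOf : Option Γ' → Bool
  | some (.bit b) => b
  | _ => false

@[simp] theorem isBit_bit (b : Bool) : isBit (some (.bit b)) = true := rfl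
@[simp] theorem isBit_comma : isBit (some .comma) = false := rfl
@[simp] theorem isBit_none : isBit none = false := rfl
@[simp] theorem bitOf_bit (b : Bool) : bitOf (some (.bit b)) = b := rfl
@[simp] theorem bitOf_comma : bitOf (some .comma) = false := rfl
@[simp] theorem bitOf_none : bitOf none = false := rfl

open Turing.TM2.Stmt in
/-- Reject: clean up, with no answer. -/
def rejectStmt : TM2.Stmt StkAlphabet Lbl Reg :=
  load (fun v => { v with ans := none }) <| goto fun _ => .clean

open Turing.TM2.Stmt in
/-- The program.
* `readN`, `readP`, `readQ` read `n` and the numerator and denominator of `ε`; `nn` receives the bits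
  of `n` with a leading zero, and `ss` receives `size den - size num + 1` marks.
* `flip` and `readI` compare `i` with `n`, copy `i` padded to `k` bits to `ii`, and put `k` marks
  on `nn`.
* `readJ` distributes `3 k` bits of `j` to `aa`, `bb` and `rr`; a `1` is put on top of `aa`.
* `outer`, `inner`, `restore` compute the hash: for each bit of `ii`, `inner` adds a multiple of `aa`
  to `bb`, `restore` moves both back, and the finished top bit of `bb` goes to `uu`.
* `scan` looks for the topmost `1` of the hash and keeps the corresponding bit of `rr`.
* `check` compares the level of the hash with the number of marks on `ss`.
* `clean` empties all stacks and writes the answer. -/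
def prog : Lbl → TM2.Stmt StkAlphabet Lbl Reg
  | .readN =>
    pop .inp (fun v o => { v with c := o }) <|
    branch (fun v => isBit v.c)
      (push .nn (fun v => bitOf v.c) <| goto fun _ => .readN)
      (push .nn (fun _ => false) <| goto fun _ => .readP)
  | .readP =>
    pop .inp (fun v o => { v with c := o }) <|
    branch (fun v => isBit v.c)
      (push .pp (fun v => bitOf v.c) <| goto fun _ => .readP)
      (goto fun _ => .readQ)
  | .readQ =>
    pop .inp (fun v o => { v with c := o }) <|
    branch (fun v => isBit v.c)
      (pop .pp (fun v o => { v with x := o }) <|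
        branch (fun v => v.x.isSome)
          (goto fun _ => .readQ)
          (push .ss (fun _ => true) <| goto fun _ => .readQ))
      (push .ss (fun _ => true) <| goto fun _ => .flip)
  | .flip =>
    pop .nn (fun v o => { v with x := o }) <|
    branch (fun v => v.x.isSome)
      (push .mm (fun v => v.x.getD false) <| goto fun _ => .flip)
      (peek .inp (fun v o => { v with c := o }) <|
        branch (fun v => isBit v.c)
          (load (fun v => { v with f := true }) <| goto fun _ => .readI)
          rejectStmt)
  | .readI =>
    pop .mm (fun v o => { v with x := o }) <|
    branch (fun v => v.x.isSome)
      (peek .inp (fun v o => { v with c := o }) <|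
        load (fun v => { v with f := if bitOf v.c = v.x.getD false then v.f else v.x.getD false }) <|
        push .ii (fun v => bitOf v.c) <|
        push .nn (fun _ => true) <|
        branch (fun v => isBit v.c)
          (pop .inp (fun v _ => v) <| goto fun _ => .readI)
          (goto fun _ => .readI))
      (pop .inp (fun v o => { v with c := o }) <|
        branch (fun v => !isBit v.c && v.f)
          (peek .inp (fun v o => { v with c := o }) <|
            branch (fun v => isBit v.c)
              (goto fun _ => .readJ)
              rejectStmt)
          rejectStmt)
  | .readJ =>
    pop .nn (fun v o => { v with x := o }) <|
    branch (fun v => v.x.isSome)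
      (pop .inp (fun v o => { v with c := o }) <|
        push .aa (fun v => bitOf v.c) <|
        pop .inp (fun v o => { v with c := o }) <|
        push .bb (fun v => bitOf v.c) <|
        pop .inp (fun v o => { v with c := o }) <|
        push .rr (fun v => bitOf v.c) <|
        goto fun _ => .readJ)
      (pop .inp (fun v o => { v with c := o }) <|
        branch (fun v => isBit v.c)
          rejectStmt
          (push .aa (fun _ => true) <| goto fun _ => .outer))
  | .outer =>
    pop .ii (fun v o => { v with x := o }) <|
    branch (fun v => v.x.isSome)
      (goto fun _ => .inner)
      (load (fun v => { v with y := some false }) <| goto fun _ => .scan)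
  | .inner =>
    pop .bb (fun v o => { v with y := o }) <|
    branch (fun v => v.y.isSome)
      (pop .aa (fun v o => { v with z := o }) <|
        push .ca (fun v => v.z.getD false) <|
        push .cb (fun v => v.y.getD false ^^ (v.x.getD false && v.z.getD false)) <|
        goto fun _ => .inner)
      (goto fun _ => .restore)
  | .restore =>
    pop .ca (fun v o => { v with z := o }) <|
    branch (fun v => v.z.isSome)
      (push .aa (fun v => v.z.getD false) <|
        pop .cb (fun v o => { v with y := o }) <|
        push .bb (fun v => v.y.getD false) <|
        goto fun _ => .restore)
      (pop .bb (fun v o => { v with y := o }) <|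
        push .uu (fun v => v.y.getD false) <|
        goto fun _ => .outer)
  | .scan =>
    pop .uu (fun v o => { v with x := o }) <|
    branch (fun v => v.x == some false)
      (pop .rr (fun v o => { v with y := o }) <| goto fun _ => .scan)
      (goto fun _ => .check)
  | .check =>
    pop .uu (fun v o => { v with x := o }) <|
    branch (fun v => v.x.isSome)
      (pop .ss (fun v o => { v with z := o }) <|
        branch (fun v => v.z.isSome)
          (goto fun _ => .check)
          (load (fun v => { v with ans := some false }) <| goto fun _ => .clean))
      (load (fun v => { v with ans := v.y }) <| goto fun _ => .clean)
  | .clean =>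
    load (fun v => { v with f := false }) <|
    pop .inp (fun v o => { v with f := v.f || o.isSome }) <|
    pop .nn (fun v o => { v with f := v.f || o.isSome }) <|
    pop .mm (fun v o => { v with f := v.f || o.isSome }) <|
    pop .pp (fun v o => { v with f := v.f || o.isSome }) <|
    pop .ss (fun v o => { v with f := v.f || o.isSome }) <|
    pop .ii (fun v o => { v with f := v.f || o.isSome }) <|
    pop .aa (fun v o => { v with f := v.f || o.isSome }) <|
    pop .bb (fun v o => { v with f := v.f || o.isSome }) <|
    pop .rr (fun v o => { v with f := v.f || o.isSome }) <|
    pop .ca (fun v o => { v with f := v.f || o.isSome }) <|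
    pop .cb (fun v o => { v with f := v.f || o.isSome }) <|
    pop .uu (fun v o => { v with f := v.f || o.isSome }) <|
    branch (fun v => v.f)
      (goto fun _ => .clean)
      (branch (fun v => v.ans.isSome)
        (push .out (fun v => v.ans.getD false) <| load (fun _ => {}) halt)
        (load (fun _ => {}) halt))

/-- Configurations of the machine. -/
abbrev Config := TM2.Cfg StkAlphabet Lbl Reg

/-- The configuration with label `l`, registers `v` and stacks `T`. -/
abbrev cfg (l : Lbl) (v : Reg) (T : Tapes) : Config := ⟨some l, v, T.stk⟩

/-- The configuration `c'` is reached from `c` in at most `t` steps. -/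
def ReachesIn (c c' : Config) (t : ℕ) : Prop :=
  ∃ s ≤ t, (flip bind (TM2.step prog))^[s] (some c) = some c'

theorem ReachesIn.refl (c : Config) : ReachesIn c c 0 := ⟨0, le_rfl, rfl⟩

theorem ReachesIn.trans {c c' c'' : Config} {s t : ℕ} (h : ReachesIn c c' s)
    (h' : ReachesIn c' c'' t) : ReachesIn c c'' (s + t) := by
  obtain ⟨a, ha, ea⟩ := h
  obtain ⟨b, hb, eb⟩ := h'
  exact ⟨b + a, by omega, by rw [Function.iterate_add_apply, ea, eb]⟩

theorem ReachesIn.mono {c c' : Config} {s t : ℕ} (h : ReachesIn c c' s) (hst : s ≤ t) :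
    ReachesIn c c' t := by
  obtain ⟨a, ha, ea⟩ := h
  exact ⟨a, ha.trans hst, ea⟩

theorem ReachesIn.step {c c' : Config} (h : TM2.step prog c = some c') : ReachesIn c c' 1 :=
  ⟨1, le_rfl, h⟩

theorem ReachesIn.head {c c' c'' : Config} {t : ℕ} (h : TM2.step prog c = some c')
    (h' : ReachesIn c' c'' t) : ReachesIn c c'' (t + 1) :=
  (add_comm 1 t) ▸ (ReachesIn.step h).trans h'

/-! ### Reading the input -/

theorem encodeNat_zero : encodeNat 0 = [] := rfl

theorem bit_testBit_zero (n : ℕ) : Nat.bit (n.testBit 0) (n / 2) = n := by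
  rw [Nat.testBit_zero, Nat.bit_val]
  rcases Nat.mod_two_eq_zero_or_one n with h | h <;> simp [h] <;> omega

theorem encodeNat_of_ne_zero {n : ℕ} (hn : n ≠ 0) :
    encodeNat n = n.testBit 0 :: encodeNat (n / 2) := by
  have h : ∀ (b : Bool) (m : ℕ), Nat.bit b m ≠ 0 →
      encodeNat (Nat.bit b m) = b :: encodeNat m := by
    intro b m hne
    unfold encodeNat
    rw [← Num.ofNat'_eq, Num.ofNat'_bit, Num.ofNat'_eq]
    rcases hm : (m : Num) with - | q
    · have hm0 : m = 0 := by
        have := Num.to_of_nat m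
        rw [hm] at this
        exact this.symm
      subst hm0
      cases b
      · exact absurd rfl hne
      · rfl
    · cases b <;> rfl
  have h2 := bit_testBit_zero n
  have := h (n.testBit 0) (n / 2) (h2.symm ▸ hn)
  rwa [h2] at this

theorem length_encodeNat (n : ℕ) : (encodeNat n).length = n.size := by
  induction n using Nat.strong_induction_on with
  | _ n ih =>
    rcases eq_or_ne n 0 with rfl | hn
    · simp [encodeNat_zero]
    · rw [encodeNat_of_ne_zero hn, List.length_cons, ih _ (by omega)]
      have h2 := bit_testBit_zero n
      have := Nat.size_bit (b := n.testBit 0) (n := n / 2) (by rwa [h2])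
      rw [h2] at this
      exact this.symm

/-- The list `[f 0, …, f (k - 1)]`. -/
def seg (f : ℕ → Bool) : ℕ → List Bool
  | 0 => []
  | k + 1 => f 0 :: seg (fun p => f (p + 1)) k

/-- The list `[f (k - 1), …, f 0]`. -/
def down (f : ℕ → Bool) : ℕ → List Bool
  | 0 => []
  | k + 1 => f k :: down f k

theorem length_seg (f : ℕ → Bool) (k : ℕ) : (seg f k).length = k := by
  induction k generalizing f with
  | zero => rfl
  | succ k ih => simp [seg, ih]

theorem length_down (f : ℕ → Bool) (k : ℕ) : (down f k).length = k := by
  induction k with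
  | zero => rfl
  | succ k ih => simp [down, ih]

theorem down_succ_append (f : ℕ → Bool) (k : ℕ) (l : List Bool) :
    down f (k + 1) ++ l = down (fun p => f (p + 1)) k ++ f 0 :: l := by
  induction k with
  | zero => rfl
  | succ k ih => rw [down, List.cons_append, ih]; rfl

theorem seg_congr {f g : ℕ → Bool} {k : ℕ} (h : ∀ p < k, f p = g p) : seg f k = seg g k := by
  induction k generalizing f g with
  | zero => rfl
  | succ k ih => rw [seg, seg, h 0 (by omega), ih fun p hp => h (p + 1) (by omega)]

theorem down_eq_seg (f : ℕ → Bool) (k : ℕ) : down f k = seg (fun p => f (k - 1 - p)) k := by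
  induction k with
  | zero => rfl
  | succ k ih =>
    rw [down, ih, seg]
    congr 1
    exact seg_congr fun p hp => by congr 1; omega

theorem encodeNat_append_false (n : ℕ) :
    encodeNat n ++ [false] = seg n.testBit (n.size + 1) := by
  induction n using Nat.strong_induction_on with
  | _ n ih =>
    rcases eq_or_ne n 0 with rfl | hn
    · simp [encodeNat_zero, seg]
    · rw [← length_encodeNat, encodeNat_of_ne_zero hn, List.cons_append, ih _ (by omega),
        List.length_cons, length_encodeNat]
      change _ = n.testBit 0 :: seg (fun p => n.testBit (p + 1)) ((n / 2).size + 1)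
      simp only [Nat.testBit_add_one]

section
variable (w : List Bool) (rest : List Γ') (T : Tapes) (v : Reg)

theorem readN_spec (h : T.inp = w.map Γ'.bit ++ Γ'.comma :: rest) :
    ∃ v', ReachesIn (cfg .readN v T)
      (cfg .readP v' { T with inp := rest, nn := false :: (w.reverse ++ T.nn) }) (w.length + 1) := by
  induction w generalizing T v with
  | nil =>
    refine ⟨{ v with c := some Γ'.comma }, ReachesIn.step ?_⟩
    simp [prog, h]
  | cons b w ih =>
    obtain ⟨v', h'⟩ := ih { T with inp := w.map Γ'.bit ++ Γ'.comma :: rest, nn := b :: T.nn }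
      { v with c := some (Γ'.bit b) } rfl
    refine ⟨v', ?_⟩
    simp only [List.reverse_cons, List.append_assoc, List.singleton_append]
    refine ReachesIn.head ?_ h'
    simp [prog, h]

theorem readP_spec (h : T.inp = w.map Γ'.bit ++ Γ'.comma :: rest) :
    ∃ v', ReachesIn (cfg .readP v T)
      (cfg .readQ v' { T with inp := rest, pp := w.reverse ++ T.pp }) (w.length + 1) := by
  induction w generalizing T v with
  | nil =>
    refine ⟨{ v with c := some Γ'.comma }, ReachesIn.step ?_⟩
    simp [prog, h]
  | cons b w ih =>
    obtain ⟨v', h'⟩ := ih { T with inp := w.map Γ'.bit ++ Γ'.comma :: rest, pp := b :: T.pp }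
      { v with c := some (Γ'.bit b) } rfl
    refine ⟨v', ?_⟩
    simp only [List.reverse_cons, List.append_assoc, List.singleton_append]
    refine ReachesIn.head ?_ h'
    simp [prog, h]

theorem readQ_spec (h : T.inp = w.map Γ'.bit ++ Γ'.comma :: rest) :
    ∃ v', ReachesIn (cfg .readQ v T)
      (cfg .flip v' { T with
        inp := rest
        pp := T.pp.drop w.length
        ss := true :: (List.replicate (w.length - T.pp.length) true ++ T.ss) }) (w.length + 1) := by
  induction w generalizing T v with
  | nil =>
    refine ⟨{ v with c := some Γ'.comma }, ReachesIn.step ?_⟩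
    simp [prog, h]
  | cons b w ih =>
    rcases hp : T.pp with - | ⟨p, l⟩
    · obtain ⟨v', h'⟩ := ih
        { T with inp := w.map Γ'.bit ++ Γ'.comma :: rest, pp := [], ss := true :: T.ss }
        { v with c := some (Γ'.bit b), x := none } rfl
      refine ⟨v', ?_⟩
      simp only [List.length_cons, List.length_nil, Nat.sub_zero, List.drop_nil,
        List.replicate_succ', List.append_assoc, List.singleton_append] at h' ⊢
      refine ReachesIn.head ?_ h'
      simp [prog, h, hp]
    · obtain ⟨v', h'⟩ := ih { T with inp := w.map Γ'.bit ++ Γ'.comma :: rest, pp := l }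
        { v with c := some (Γ'.bit b), x := some p } rfl
      refine ⟨v', ?_⟩
      simp only [List.length_cons, List.drop_succ_cons, Nat.add_sub_add_right]
      refine ReachesIn.head ?_ h'
      simp [prog, h, hp]

theorem flip_spec (h : T.nn = w) :
    ∃ v', (isBit T.inp.head? → v'.f = true) ∧ ReachesIn (cfg .flip v T)
      (if isBit T.inp.head? then cfg .readI v' { T with nn := [], mm := w.reverse ++ T.mm }
        else cfg .clean { v' with ans := none } { T with nn := [], mm := w.reverse ++ T.mm })
      (w.length + 1) := by
  induction w generalizing T v with
  | nil =>
    refine ⟨{ v with c := T.inp.head?, x := none, f := isBit T.inp.head? || v.f }, ?_, ?_⟩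
    · simp +contextual
    · split_ifs with hb
      · refine ReachesIn.step ?_
        simp [prog, h, hb]
      · refine ReachesIn.step ?_
        simp [prog, rejectStmt, h, hb]
  | cons b w ih =>
    obtain ⟨v', hf, h'⟩ := ih { T with nn := w, mm := b :: T.mm } { v with x := some b } rfl
    refine ⟨v', hf, ?_⟩
    simp only [List.reverse_cons, List.append_assoc, List.singleton_append]
    refine ReachesIn.head ?_ h'
    simp [prog, h]

end

/-- The comparison runs from the least significant bit; the flag records whether the part of `i` read
so far is at most the corresponding part of `n`. -/
theorem readI_spec (k i n : ℕ) (hn : n < 2 ^ k) (rest : List Γ') (T : Tapes) (v : Reg)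
    (h : T.inp = (encodeNat i).map Γ'.bit ++ Γ'.comma :: rest) (hm : T.mm = seg n.testBit k) :
    ∃ v', ((i / 2 ^ k = 0 ∧ v'.f = true) ↔ (i < n ∨ i = n ∧ v.f = true)) ∧
      ReachesIn (cfg .readI v T) (cfg .readI v' { T with
        inp := (encodeNat (i / 2 ^ k)).map Γ'.bit ++ Γ'.comma :: rest
        mm := []
        ii := down i.testBit k ++ T.ii
        nn := List.replicate k true ++ T.nn }) k := by
  induction k generalizing i n T v with
  | zero =>
    refine ⟨v, ?_, ?_⟩
    · have : n = 0 := by simpa using hn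
      subst this
      simp
    · have : T = { T with
          inp := (encodeNat (i / 2 ^ 0)).map Γ'.bit ++ Γ'.comma :: rest
          mm := []
          ii := down i.testBit 0 ++ T.ii
          nn := List.replicate 0 true ++ T.nn } := by
        simp only [pow_zero, Nat.div_one, down, List.replicate_zero, List.nil_append]
        rw [← h, show [] = T.mm from hm.symm]
      rw [← this]
      exact ReachesIn.refl _
  | succ k ih =>
    obtain ⟨v', hv', h'⟩ := ih (i / 2) (n / 2) (by rw [pow_succ] at hn; omega)
      { T with
        inp := (encodeNat (i / 2)).map Γ'.bit ++ Γ'.comma :: rest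
        mm := seg (n / 2).testBit k
        ii := i.testBit 0 :: T.ii
        nn := true :: T.nn }
      { v with
        x := some (n.testBit 0)
        c := T.inp.head?
        f := if i.testBit 0 = n.testBit 0 then v.f else n.testBit 0 } rfl rfl
    refine ⟨v', ?_, ?_⟩
    · rw [Nat.pow_succ', ← Nat.div_div_eq_div_mul, hv']
      simp only [Nat.testBit_zero]
      rcases Nat.mod_two_eq_zero_or_one i with h1 | h1 <;>
        rcases Nat.mod_two_eq_zero_or_one n with h2 | h2 <;>
        by_cases hf : v.f = true <;>
        simp only [h1, h2, hf, and_true, and_false, or_false, if_true, if_false, decide_true,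
          decide_false, reduceCtorEq, Nat.zero_ne_one] <;> omega
    · rw [down_succ_append, List.replicate_succ', List.append_assoc, List.singleton_append,
        Nat.pow_succ', ← Nat.div_div_eq_div_mul]
      simp only [Nat.testBit_add_one]
      refine ReachesIn.head ?_ h'
      rcases eq_or_ne i 0 with rfl | hi
      · simp [prog, h, hm, seg, encodeNat_zero, Nat.testBit_add_one]
      · simp [prog, h, hm, seg, encodeNat_of_ne_zero hi, Nat.testBit_add_one]

/-- What remains of a final block `j` of the input; nothing may remain of it when `j = 0`. -/
def IsLastBlock (j : ℕ) (l : List Γ') : Prop :=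
  l = (encodeNat j).map Γ'.bit ++ [Γ'.comma] ∨ j = 0 ∧ l = []

theorem IsLastBlock.tail {j : ℕ} {l : List Γ'} (h : IsLastBlock j l) :
    bitOf l.head? = j.testBit 0 ∧ isBit l.head? = decide (j ≠ 0) ∧ IsLastBlock (j / 2) l.tail := by
  rcases h with rfl | ⟨rfl, rfl⟩
  · rcases eq_or_ne j 0 with rfl | hj
    · simp [encodeNat_zero, IsLastBlock]
    · rw [encodeNat_of_ne_zero hj]
      simp [hj, IsLastBlock]
  · simp [IsLastBlock]

/-- Each round takes three bits of `j`, one for each part of the seed; beyond the end of the input,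
zeros are read. -/
theorem readJ_spec (k j : ℕ) (T : Tapes) (v : Reg) (h : IsLastBlock j T.inp)
    (hn : T.nn = List.replicate k true) :
    ∃ v' l, IsLastBlock (j / 2 ^ (3 * k)) l ∧ ReachesIn (cfg .readJ v T) (cfg .readJ v' { T with
        inp := l
        nn := []
        aa := down (fun c => j.testBit (3 * c)) k ++ T.aa
        bb := down (fun c => j.testBit (3 * c + 1)) k ++ T.bb
        rr := down (fun c => j.testBit (3 * c + 2)) k ++ T.rr }) k := by
  induction k generalizing j T v with
  | zero =>
    refine ⟨v, T.inp, by simpa using h, ?_⟩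
    simp only [down, List.nil_append]
    rw [show [] = T.nn from hn.symm]
    exact ReachesIn.refl _
  | succ k ih =>
    obtain ⟨h1, -, h2⟩ := h.tail
    obtain ⟨h3, -, h4⟩ := h2.tail
    obtain ⟨h5, -, h6⟩ := h4.tail
    rw [← Nat.testBit_add_one] at h3 h5
    rw [← Nat.testBit_add_one] at h5
    obtain ⟨v', l, hl, h'⟩ := ih _
      { T with
        inp := T.inp.tail.tail.tail
        nn := List.replicate k true
        aa := j.testBit 0 :: T.aa
        bb := j.testBit 1 :: T.bb
        rr := j.testBit 2 :: T.rr }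
      { v with x := some true, c := T.inp.tail.tail.head? } h6 rfl
    have ht : ∀ c, j.testBit (c + 3) = (j / 2 / 2 / 2).testBit c := fun c => by
      simp only [← Nat.testBit_add_one]
    refine ⟨v', l, ?_, ?_⟩
    · rw [show 3 * (k + 1) = 1 + 1 + 1 + 3 * k by ring]
      simpa only [pow_add, ← Nat.div_div_eq_div_mul, pow_one] using hl
    · simp only [down_succ_append]
      simp only [← ht] at h'
      simp only [show ∀ p, 3 * (p + 1) = 3 * p + 3 by intro p; ring,
        show ∀ p, 3 * p + 3 + 1 = 3 * p + 1 + 3 by intro p; ring,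
        show ∀ p, 3 * p + 3 + 2 = 3 * p + 2 + 3 by intro p; ring, mul_zero, zero_add]
      refine ReachesIn.head ?_ h'
      simp [prog, hn, List.replicate_succ, h1, h3, h5, -List.head?_tail, -Nat.testBit_zero]

/-! ### Computing the entry -/

/-- The Toeplitz hash over the Booleans, by the recursion that the machine follows: the first bit of
the point adds its multiple of `a` to `b`, after which the first bit of `b` is finished. -/
def toeplitzBool (a : ℕ → Bool) : (ℕ → Bool) → (ℕ → Bool) → ℕ → Bool
  | b, x, 0 => b 0 ^^ (x 0 && a 0)
  | b, x, p + 1 =>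
    toeplitzBool a (fun q => b (q + 1) ^^ (x 0 && a (q + 1))) (fun q => x (q + 1)) p

theorem bitVal_xor_and (s t u : Bool) :
    bitVal (s ^^ (t && u)) = bitVal s + bitVal t * bitVal u := by
  revert s t u
  decide

theorem bitVal_toeplitzBool (a b x : ℕ → Bool) (p : ℕ) :
    bitVal (toeplitzBool a b x p) =
      toeplitzBit (fun q => bitVal (a q)) (fun q => bitVal (b q)) (fun q => bitVal (x q)) p := by
  induction p generalizing b x with
  | zero => simp [toeplitzBool, toeplitzBit, bitVal_xor_and]
  | succ p ih =>
    rw [toeplitzBool, ih, toeplitzBit, toeplitzBit, Finset.sum_range_succ' _ (p + 1),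
      bitVal_xor_and]
    simp only [Nat.add_sub_add_right, Nat.sub_zero]
    ring

theorem zipWith_seg (f : Bool → Bool → Bool) (a b : ℕ → Bool) {k K : ℕ} (h : k ≤ K) :
    List.zipWith f (seg b k) (seg a K) = seg (fun p => f (b p) (a p)) k := by
  induction k generalizing a b K with
  | zero => rfl
  | succ k ih =>
    obtain ⟨K, rfl⟩ : ∃ K', K = K' + 1 := ⟨K - 1, by omega⟩
    simp only [seg, List.zipWith_cons_cons]
    rw [ih _ _ (by omega)]

theorem inner_spec (s : Bool) (b a : List Bool) (hlen : b.length ≤ a.length) (T : Tapes) (v : Reg)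
    (hx : v.x = some s) (hb : T.bb = b) (ha : T.aa = a) :
    ∃ v', ReachesIn (cfg .inner v T) (cfg .restore v' { T with
      bb := []
      aa := a.drop b.length
      ca := (a.take b.length).reverse ++ T.ca
      cb := (List.zipWith (fun y z => y ^^ (s && z)) b a).reverse ++ T.cb }) (b.length + 1) := by
  induction b generalizing a T v with
  | nil =>
    refine ⟨{ v with y := none }, ReachesIn.step ?_⟩
    simp [prog, hb, ha]
  | cons y b ih =>
    rcases a with - | ⟨z, a⟩
    · simp at hlen
    obtain ⟨v', h'⟩ := ih a (by simpa using hlen)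
      { T with bb := b, aa := a, ca := z :: T.ca, cb := (y ^^ (s && z)) :: T.cb }
      { v with y := some y, z := some z } hx rfl rfl
    refine ⟨v', ?_⟩
    simp only [List.length_cons, List.drop_succ_cons, List.take_succ_cons, List.zipWith_cons_cons,
      List.reverse_cons, List.append_assoc, List.singleton_append]
    refine ReachesIn.head ?_ h'
    simp [prog, hb, ha, hx]

theorem restore_spec (a b : List Bool) (hlen : a.length = b.length) (T : Tapes) (v : Reg)
    (ha : T.ca = a) (hb : T.cb = b) :
    ∃ v', ReachesIn (cfg .restore v T) (cfg .outer v' { T with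
      ca := []
      cb := []
      aa := a.reverse ++ T.aa
      bb := (b.reverse ++ T.bb).tail
      uu := (b.reverse ++ T.bb).head?.getD false :: T.uu }) (a.length + 1) := by
  induction a generalizing b T v with
  | nil =>
    obtain rfl : b = [] := List.length_eq_zero_iff.1 hlen.symm
    refine ⟨{ v with z := none, y := T.bb.head? }, ReachesIn.step ?_⟩
    simp [prog, hb, ha]
  | cons z a ih =>
    rcases b with - | ⟨y, b⟩
    · simp at hlen
    obtain ⟨v', h'⟩ := ih b (by simpa using hlen)
      { T with ca := a, cb := b, aa := z :: T.aa, bb := y :: T.bb }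
      { v with y := some y, z := some z } rfl rfl
    refine ⟨v', ?_⟩
    simp only [List.length_cons, List.reverse_cons, List.append_assoc, List.singleton_append]
    refine ReachesIn.head ?_ h'
    simp [prog, hb, ha]

/-- The hash of `x` ends up on `uu`. In each round, the round's product is added to `b` at the
current shift, so that `b` loses its finished first bit while `a` is restored unchanged. -/
theorem outer_spec (K k : ℕ) (hk : k ≤ K) (a b x : ℕ → Bool) (T : Tapes) (v : Reg)
    (hi : T.ii = seg x k) (hb : T.bb = seg b k) (ha : T.aa = seg a K)
    (hca : T.ca = []) (hcb : T.cb = []) :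
    ∃ v', v'.y = some false ∧ ReachesIn (cfg .outer v T) (cfg .scan v' { T with
      ii := []
      bb := []
      uu := down (toeplitzBool a b x) k ++ T.uu }) (k * (2 * k + 3) + 1) := by
  induction k generalizing b x T v with
  | zero =>
    refine ⟨{ v with x := none, y := some false }, rfl, ?_⟩
    refine (ReachesIn.step ?_).mono (by omega)
    simp [prog, hi, hb, seg, down]
  | succ k ih =>
    have h1 : ReachesIn (cfg .outer v T) (cfg .inner { v with x := some (x 0) }
        { T with ii := seg (fun p => x (p + 1)) k }) 1 := by
      refine ReachesIn.step ?_
      simp [prog, hi, seg]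
    obtain ⟨v2, h2⟩ := inner_spec (x 0) (seg b (k + 1)) (seg a K)
      (by simpa [length_seg] using hk) { T with ii := seg (fun p => x (p + 1)) k }
      { v with x := some (x 0) } rfl hb ha
    obtain ⟨v3, h3⟩ := restore_spec ((seg a K).take (k + 1)).reverse
      (seg (fun p => b p ^^ (x 0 && a p)) (k + 1)).reverse
      (by simpa [length_seg] using hk)
      { T with
        ii := seg (fun p => x (p + 1)) k
        bb := []
        aa := (seg a K).drop (k + 1)
        ca := ((seg a K).take (k + 1)).reverse
        cb := (seg (fun p => b p ^^ (x 0 && a p)) (k + 1)).reverse } v2 rfl rfl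
    obtain ⟨v4, hy, h4⟩ := ih (by omega) (fun p => b (p + 1) ^^ (x 0 && a (p + 1)))
      (fun p => x (p + 1))
      { T with
        ii := seg (fun p => x (p + 1)) k
        bb := seg (fun p => b (p + 1) ^^ (x 0 && a (p + 1))) k
        uu := (b 0 ^^ (x 0 && a 0)) :: T.uu } v3 rfl rfl ha hca hcb
    refine ⟨v4, hy, ?_⟩
    rw [down_succ_append]
    simp only [length_seg, zipWith_seg _ _ _ hk, ha, hb, hca, hcb, List.append_nil] at h2
    simp only [List.reverse_reverse, List.take_append_drop, List.append_nil, List.length_reverse,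
      List.length_take, length_seg, Nat.min_eq_left hk, seg, List.tail_cons, List.head?_cons,
      Option.getD_some] at h3
    simp only [ha, hb, hca, hcb] at h1 h4 ⊢
    refine (h1.trans (h2.trans (h3.trans h4))).mono ?_
    nlinarith

/-- The scan leaves the part of the hash below its topmost `1` on `uu`, and the bit of `r` at the
level of the hash in the register `y`. -/
theorem scan_spec (k : ℕ) (u r : ℕ → Bool) (w : Bool) (T : Tapes) (v : Reg) (hy : v.y = some w)
    (hu : T.uu = down u k) (hr : T.rr = down r k) :
    ∃ v' l, v'.y = some (if level (fun p => bitVal (u p)) k = k then w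
        else r (level (fun p => bitVal (u p)) k)) ∧
      ReachesIn (cfg .scan v T) (cfg .check v' { T with
        uu := down u (level (fun p => bitVal (u p)) k - 1)
        rr := l }) (k + 1) := by
  induction k generalizing w T v with
  | zero =>
    refine ⟨{ v with x := none }, T.rr, by simp [level, hy], ReachesIn.step ?_⟩
    simp [prog, hu, down, level]
  | succ k ih =>
    have hlev : level (fun p => bitVal (u p)) (k + 1) =
        if u k = false then level (fun p => bitVal (u p)) k else k + 1 := by
      rw [level]
      cases u k <;> simp [bitVal]
    rw [hlev]
    cases huk : u k
    · obtain ⟨v', l, h1, h2⟩ := ih (r k) { T with uu := down u k, rr := down r k }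
        { v with x := some false, y := some (r k) } rfl rfl rfl
      refine ⟨v', l, ?_, ?_⟩
      · have hle : level (fun p => bitVal (u p)) k ≤ k := 
          (level_le_iff _ _ _).2 fun p h3 h4 => absurd h4 (Nat.not_lt.2 h3)
        rw [h1, if_pos rfl, if_neg (Nat.ne_of_lt (Nat.lt_succ_of_le hle))]
        split_ifs with h
        · rw [h]
        · rfl
      · refine ReachesIn.head ?_ h2
        simp [prog, hu, hr, down, huk]
    · refine ⟨{ v with x := some true }, T.rr, by simp [hy], (ReachesIn.step ?_).mono (by omega)⟩
      simp [prog, hu, down, huk]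

theorem check_spec (u : List Bool) (T : Tapes) (v : Reg) (hu : T.uu = u) :
    ∃ v' T', T'.out = T.out ∧ v'.ans = (if u.length ≤ T.ss.length then v.y else some false) ∧
      ReachesIn (cfg .check v T) (cfg .clean v' T') (u.length + 1) := by
  induction u generalizing T v with
  | nil =>
    refine ⟨{ v with x := none, ans := v.y }, T, rfl, by simp, ReachesIn.step ?_⟩
    rw [show T = { T with uu := [] } by rw [← hu]]
    simp [prog]
  | cons b u ih =>
    rcases hs : T.ss with - | ⟨c, s⟩
    · refine ⟨{ v with x := some b, z := none, ans := some false }, { T with uu := u, ss := [] },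
        rfl, by simp, (ReachesIn.step ?_).mono (by omega)⟩
      simp [prog, hu, hs]
    · obtain ⟨v', T', h1, h2, h3⟩ := ih { T with uu := u, ss := s }
        { v with x := some b, z := some c } rfl
      refine ⟨v', T', h1, by simpa using h2, ReachesIn.head ?_ h3⟩
      simp [prog, hu, hs]

/-! ### Cleaning up -/

/-- The number of pushes in a statement. -/
def pushCount {K Λ σ : Type} {Γ : K → Type} : TM2.Stmt Γ Λ σ → ℕ
  | .push _ _ q => pushCount q + 1
  | .peek _ _ q => pushCount q
  | .pop _ _ q => pushCount q
  | .load _ q => pushCount q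
  | .branch _ q₁ q₂ => max (pushCount q₁) (pushCount q₂)
  | .goto _ => 0
  | .halt => 0

theorem length_stk_stepAux_le {K Λ σ : Type} [DecidableEq K] {Γ : K → Type} (q : TM2.Stmt Γ Λ σ)
    (v : σ) (S : ∀ k, List (Γ k)) (k : K) :
    ((TM2.stepAux q v S).stk k).length ≤ (S k).length + pushCount q := by
  induction q generalizing v S with
  | push k' f q ih =>
    refine (ih _ _).trans ?_
    rw [pushCount]
    by_cases h : k = k'
    · subst h
      rw [Function.update_self, List.length_cons]
      omega
    · rw [Function.update_of_ne h]
      omega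
  | peek k' f q ih => exact ih _ _
  | pop k' f q ih =>
    refine (ih _ _).trans ?_
    rw [pushCount]
    by_cases h : k = k'
    · subst h
      rw [Function.update_self, List.length_tail]
      omega
    · rw [Function.update_of_ne h]
  | load f q ih => exact ih _ _
  | branch f q₁ q₂ ih₁ ih₂ =>
    rw [TM2.stepAux, pushCount]
    cases f v
    · exact (ih₂ _ _).trans (by omega)
    · exact (ih₁ _ _).trans (by omega)
  | goto f => exact Nat.le_add_right _ _
  | halt => exact Nat.le_add_right _ _

theorem pushCount_prog_le (l : Lbl) : pushCount (prog l) ≤ 3 := by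
  cases l <;> simp [prog, rejectStmt, pushCount]

/-- No stack grows by more than three symbols per step. -/
theorem ReachesIn.length_le {c c' : Config} {t : ℕ} (h : ReachesIn c c' t) (k : Stk) :
    (c'.stk k).length ≤ (c.stk k).length + 3 * t := by
  obtain ⟨s, hs, he⟩ := h
  suffices (c'.stk k).length ≤ (c.stk k).length + 3 * s by omega
  clear hs
  induction s generalizing c' with
  | zero =>
    obtain rfl : c = c' := by simpa using he
    simp
  | succ s ih =>
    rw [Function.iterate_succ_apply'] at he
    rcases hd : (flip bind (TM2.step prog))^[s] (some c) with - | d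
    · rw [hd] at he
      cases he
    · rw [hd] at he
      have hstep : TM2.step prog d = some c' := he
      have h1 := ih hd
      obtain ⟨_ | l, v, S⟩ := d
      · cases hstep
      · obtain rfl : TM2.stepAux (prog l) v S = c' := by simpa using hstep
        have h2 := length_stk_stepAux_le (prog l) v S k
        have h3 := pushCount_prog_le l
        dsimp only at h1
        omega

/-- Whether a stack other than the output is nonempty. -/
def Tapes.anyWork (T : Tapes) : Bool :=
  T.inp.head?.isSome || T.nn.head?.isSome || T.mm.head?.isSome || T.pp.head?.isSome ||
    T.ss.head?.isSome || T.ii.head?.isSome || T.aa.head?.isSome || T.bb.head?.isSome ||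
    T.rr.head?.isSome || T.ca.head?.isSome || T.cb.head?.isSome || T.uu.head?.isSome

/-- All stacks other than the output with their top element removed. -/
def Tapes.popWork (T : Tapes) : Tapes where
  inp := T.inp.tail
  nn := T.nn.tail
  mm := T.mm.tail
  pp := T.pp.tail
  ss := T.ss.tail
  ii := T.ii.tail
  aa := T.aa.tail
  bb := T.bb.tail
  rr := T.rr.tail
  ca := T.ca.tail
  cb := T.cb.tail
  uu := T.uu.tail
  out := T.out

theorem clean_step (T : Tapes) (v : Reg) (h : T.anyWork = true) :
    TM2.step prog (cfg .clean v T) = some (cfg .clean { v with f := true } T.popWork) := by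
  simp only [prog, TM2.step, TM2.stepAux, Tapes.stk, update_stk_inp, update_stk_nn, update_stk_mm,
    update_stk_pp, update_stk_ss, update_stk_ii, update_stk_aa, update_stk_bb, update_stk_rr,
    update_stk_ca, update_stk_cb, update_stk_uu, Bool.false_or]
  rw [Tapes.anyWork] at h
  rw [h]
  rfl

theorem clean_halt (v : Reg) :
    TM2.step prog (cfg .clean v {}) =
      some ⟨none, {}, ({ out := v.ans.toList } : Tapes).stk⟩ := by
  rcases h : v.ans with - | b <;> simp [prog, h]

theorem clean_spec (t : ℕ) (T : Tapes) (v : Reg) (hout : T.out = [])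
    (hlen : ∀ k, (T.stk k).length ≤ t) :
    ReachesIn (cfg .clean v T) ⟨none, {}, ({ out := v.ans.toList } : Tapes).stk⟩ (t + 1) := by
  induction t generalizing T v with
  | zero =>
    have h : T = {} := by
      have h1 : ∀ k, T.stk k = [] := fun k => List.length_eq_zero_iff.1 (Nat.le_zero.1 (hlen k))
      obtain ⟨⟩ := T
      rw [Tapes.mk.injEq]
      exact ⟨h1 .inp, h1 .nn, h1 .mm, h1 .pp, h1 .ss, h1 .ii, h1 .aa, h1 .bb, h1 .rr, h1 .ca,
        h1 .cb, h1 .uu, h1 .out⟩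
    subst h
    exact ReachesIn.step (clean_halt v)
  | succ t ih =>
    cases h : T.anyWork
    · have h : T = {} := by
        obtain ⟨⟩ := T
        simpa [Tapes.anyWork, and_assoc] using And.intro h hout
      subst h
      exact (ReachesIn.step (clean_halt v)).mono (by omega)
    · refine ReachesIn.head (clean_step T v h) (ih _ _ hout fun k => ?_)
      have := hlen k
      cases k <;> simp only [Tapes.stk, Tapes.popWork, List.length_tail] at this ⊢ <;>
        first | omega | simp [hout]

/-! ### Correctness of the machine -/

theorem level_congr {u u' : ℕ → ZMod 2} {k : ℕ} (h : ∀ p < k, u p = u' p) :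
    level u k = level u' k := by
  induction k with
  | zero => rfl
  | succ k ih => rw [level, level, h k (by omega), ih fun p hp => h p (by omega)]

/-- The answer that the machine extracts from the bits of `i` and `j` is the entry. -/
theorem bitVal_machineAnswer (k d i j : ℕ) (a u : ℕ → Bool) (ha : a 0 = true)
    (ha' : ∀ c < k, a (c + 1) = j.testBit (3 * (k - 1 - c)))
    (hu : u = toeplitzBool a (fun p => j.testBit (3 * (k - 1 - p) + 1))
      (fun p => i.testBit (k - 1 - p))) :
    bitVal (if level (fun p => bitVal (u p)) k - 1 ≤ d + 1 then
        (if level (fun p => bitVal (u p)) k = k then false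
          else j.testBit (3 * level (fun p => bitVal (u p)) k + 2)) else false) =
      toeplitzEntry k (d + 2) i j := by
  have hl : level (fun p => bitVal (u p)) k =
      level (toeplitzBit (consOne (seedA k j)) (seedB k j) (pointBits k i)) k := by
    refine level_congr fun p hp => ?_
    rw [hu, bitVal_toeplitzBool]
    unfold toeplitzBit
    congr 1
    · simp [seedB, hp]
    · refine Finset.sum_congr rfl fun q hq => ?_
      rw [pointBits]
      congr 1
      rcases hc : p - q with - | c
      · simp [ha, consOne, bitVal]
      · simp only [ha' c (by omega), consOne, seedA, if_pos (show c < k by omega)]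
  unfold toeplitzEntry
  rw [hl]
  generalize hlv : level (toeplitzBit (consOne (seedA k j)) (seedB k j) (pointBits k i)) k = l
  have hlk : l ≤ k := hlv ▸ (level_le_iff _ _ _).2 fun p h3 h4 => absurd h4 (Nat.not_lt.2 h3)
  unfold levelCoeff seedR
  rcases hlk.lt_or_eq with h | rfl
  · simp only [h, h.ne, true_and, if_true, if_false]
    by_cases h2 : l ≤ d + 2
    · rw [if_pos (by omega), if_pos h2]
    · rw [if_neg (by omega), if_neg h2]
      rfl
  · simp [bitVal]

theorem isBit_head_encodeNat (n : ℕ) (rest : List Γ') :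
    isBit ((encodeNat n).map Γ'.bit ++ Γ'.comma :: rest).head? = decide (n ≠ 0) := by
  rcases eq_or_ne n 0 with rfl | hn
  · simp [encodeNat_zero]
  · simp [encodeNat_of_ne_zero hn, hn]

/-- The query is rejected if bits of `i` remain after `k` bits, or if the comparison failed. -/
theorem readI_reject (i : ℕ) (rest : List Γ') (T : Tapes) (v : Reg)
    (h : T.inp = (encodeNat i).map Γ'.bit ++ Γ'.comma :: rest) (hm : T.mm = [])
    (hi : ¬ (i = 0 ∧ v.f = true)) :
    ∃ v' T', T'.out = T.out ∧ v'.ans = none ∧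
      ReachesIn (cfg .readI v T) (cfg .clean v' T') 1 := by
  refine ⟨{ v with x := none, c := T.inp.head?, ans := none },
    { T with mm := [], inp := T.inp.tail }, rfl, rfl, ReachesIn.step ?_⟩
  rcases eq_or_ne i 0 with rfl | hi0
  · simp [prog, rejectStmt, h, hm, encodeNat_zero, show v.f = false by simpa using hi]
  · simp [prog, rejectStmt, h, hm, encodeNat_of_ne_zero hi0]

/-- If `i` passed the comparison, the machine goes on to `j`, unless `j = 0`. -/
theorem readI_accept (rest : List Γ') (T : Tapes) (v : Reg) (h : T.inp = Γ'.comma :: rest)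
    (hm : T.mm = []) (hf : v.f = true) :
    ∃ v', ReachesIn (cfg .readI v T) (if isBit rest.head? then cfg .readJ v' { T with inp := rest }
      else cfg .clean { v' with ans := none } { T with inp := rest }) 1 := by
  refine ⟨{ v with x := none, c := rest.head? }, ReachesIn.step ?_⟩
  rw [show T = { T with mm := [] } by rw [← hm]]
  split_ifs with hb <;> simp [prog, rejectStmt, h, hb, hf]

/-- After `3 k` bits of `j`, the query is rejected if bits of `j` remain. -/
theorem readJ_end (j : ℕ) (T : Tapes) (v : Reg) (h : IsLastBlock j T.inp) (hn : T.nn = []) :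
    ∃ v', ReachesIn (cfg .readJ v T)
      (if j = 0 then cfg .outer v' { T with inp := T.inp.tail, aa := true :: T.aa }
        else cfg .clean { v' with ans := none } { T with inp := T.inp.tail }) 1 := by
  have hb := h.tail.2.1
  refine ⟨{ v with x := none, c := T.inp.head? }, ReachesIn.step ?_⟩
  rw [show T = { T with nn := [] } by rw [← hn]]
  split_ifs with hj <;> simp [prog, rejectStmt, hb, hj]

/-- The machine computes the answer, up to cleaning up. -/
theorem run_spec (n p q i j : ℕ) (hpq : p.size ≤ q.size) :
    ∃ v' T', T'.out = [] ∧
      v'.ans = (if (1 ≤ i ∧ i ≤ n) ∧ (1 ≤ j ∧ j < 2 ^ (3 * (n.size + 1))) then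
        some (decide (toeplitzEntry (n.size + 1) (q.size - p.size + 2) i j = 1)) else none) ∧
      ReachesIn (cfg .readN {} { inp := encodeTuple [n, p, q, i, j] }) (cfg .clean v' T')
        (2 * (n.size + 1) ^ 2 + 9 * (n.size + 1) + p.size + q.size + 10) := by
  have henc : encodeTuple [n, p, q, i, j] = (encodeNat n).map Γ'.bit ++ Γ'.comma ::
      ((encodeNat p).map Γ'.bit ++ Γ'.comma :: ((encodeNat q).map Γ'.bit ++ Γ'.comma ::
        ((encodeNat i).map Γ'.bit ++ Γ'.comma :: ((encodeNat j).map Γ'.bit ++ [Γ'.comma])))) := by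
    simp [encodeTuple]
  set k := n.size + 1 with hk
  set Rj := (encodeNat j).map Γ'.bit ++ [Γ'.comma] with hRj
  set Ri := (encodeNat i).map Γ'.bit ++ Γ'.comma :: Rj with hRi
  set Rq := (encodeNat q).map Γ'.bit ++ Γ'.comma :: Ri with hRq
  set Rp := (encodeNat p).map Γ'.bit ++ Γ'.comma :: Rq with hRp
  set marks := true :: List.replicate (q.size - p.size) true with hmarks
  obtain ⟨v1, h1⟩ := readN_spec _ _ { inp := encodeTuple [n, p, q, i, j] } {} henc
  obtain ⟨v2, h2⟩ := readP_spec (encodeNat p) Rq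
    { inp := Rp, nn := false :: (encodeNat n).reverse } v1 rfl
  obtain ⟨v3, h3⟩ := readQ_spec (encodeNat q) Ri
    { inp := Rq, nn := false :: (encodeNat n).reverse, pp := (encodeNat p).reverse } v2 rfl
  obtain ⟨v4, hf4, h4⟩ := flip_spec (false :: (encodeNat n).reverse)
    { inp := Ri, nn := false :: (encodeNat n).reverse, ss := marks } v3 rfl
  have hpp : List.drop q.size (encodeNat p).reverse = [] :=
    List.drop_eq_nil_of_le (by simpa [length_encodeNat] using hpq)
  simp only [List.append_nil, length_encodeNat, List.length_reverse, hpp, List.length_cons,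
    List.reverse_cons, List.reverse_reverse, encodeNat_append_false, ← hk, ← hmarks] at h1 h2 h3 h4
  have h14 := h1.trans (h2.trans (h3.trans h4))
  clear h1 h2 h3 h4
  simp only [hRi, isBit_head_encodeNat] at hf4 h14
  by_cases hi0 : i = 0
  · refine ⟨_, _, ?_, ?_, ReachesIn.mono (by simpa only [hi0, ne_eq, not_true, decide_false,
      if_false, Bool.false_eq_true] using h14) ?_⟩
    · rfl
    · simp [hi0]
    · nlinarith
  simp only [hi0, ne_eq, not_false_iff, decide_true, if_true, true_imp_iff] at hf4 h14
  obtain ⟨v5, hf5, h5⟩ := readI_spec k i n ((Nat.lt_size_self n).trans_le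
    (Nat.pow_le_pow_right (by norm_num) (by omega))) Rj
    { inp := Ri, mm := seg n.testBit k, ss := marks } v4 rfl rfl
  have h15 := h14.trans h5
  clear h14 h5
  simp only [hf4, and_true, List.append_nil] at hf5 h15
  by_cases hin : i ≤ n
  swap
  · have hrej : ¬ (i / 2 ^ k = 0 ∧ v5.f = true) := by rw [hf5]; omega
    obtain ⟨v6, T6, ho, ha, h6⟩ := readI_reject (i / 2 ^ k) Rj
      { inp := (encodeNat (i / 2 ^ k)).map Γ'.bit ++ Γ'.comma :: Rj, ss := marks,
        ii := down i.testBit k, nn := List.replicate k true } v5 rfl rfl hrej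
    refine ⟨v6, T6, ho, ?_, (h15.trans h6).mono (by nlinarith)⟩
    rw [ha, if_neg (by omega)]
  obtain ⟨hik, hf⟩ := hf5.2 (by omega)
  rw [hik, encodeNat_zero] at h15
  obtain ⟨v6, h6⟩ := readI_accept Rj
    { inp := Γ'.comma :: Rj, ss := marks, ii := down i.testBit k, nn := List.replicate k true }
    v5 rfl rfl hf
  have h16 := h15.trans h6
  clear h15 h6
  simp only [hRj, isBit_head_encodeNat] at h16
  by_cases hj0 : j = 0
  · simp only [hj0, ne_eq, not_true, decide_false, if_false, Bool.false_eq_true] at h16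
    subst hj0
    refine ⟨_, _, ?_, ?_, h16.mono (by nlinarith)⟩
    · rfl
    · simp
  simp only [hj0, ne_eq, not_false_iff, decide_true, if_true] at h16
  obtain ⟨v7, l, hl, h7⟩ := readJ_spec k j
    { inp := Rj, ss := marks, ii := down i.testBit k, nn := List.replicate k true }
    v6 (Or.inl rfl) rfl
  have h17 := h16.trans h7
  clear h16 h7
  simp only [List.append_nil] at h17
  obtain ⟨v8, h8⟩ := readJ_end _
    { inp := l, ss := marks, ii := down i.testBit k, aa := down (fun c => j.testBit (3 * c)) k,
      bb := down (fun c => j.testBit (3 * c + 1)) k,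
      rr := down (fun c => j.testBit (3 * c + 2)) k } v7 hl rfl
  have h18 := h17.trans h8
  clear h17 h8
  have hjk : j / 2 ^ (3 * k) = 0 ↔ j < 2 ^ (3 * k) := Nat.div_eq_zero_iff_lt (Nat.two_pow_pos _)
  by_cases hjm : j < 2 ^ (3 * k)
  swap
  · rw [if_neg (by rwa [hjk])] at h18
    refine ⟨_, _, ?_, ?_, h18.mono (by nlinarith)⟩
    · rfl
    · rw [if_neg (fun h => hjm h.2.2)]
  rw [if_pos (hjk.2 hjm)] at h18
  set a : ℕ → Bool := fun c => match c with
    | 0 => true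
    | c + 1 => j.testBit (3 * (k - 1 - c)) with ha
  obtain ⟨v9, hy, h9⟩ := outer_spec (k + 1) k (by omega) a
    (fun p => j.testBit (3 * (k - 1 - p) + 1)) (fun p => i.testBit (k - 1 - p))
    { inp := l.tail, ss := marks, ii := down i.testBit k,
      aa := true :: down (fun c => j.testBit (3 * c)) k,
      bb := down (fun c => j.testBit (3 * c + 1)) k,
      rr := down (fun c => j.testBit (3 * c + 2)) k } v8
    (down_eq_seg _ _) (down_eq_seg _ _)
    (show true :: down (fun c => j.testBit (3 * c)) k = seg a (k + 1) by rw [down_eq_seg]; rfl)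
    rfl rfl
  have h19 := h18.trans h9
  clear h18 h9
  simp only [List.append_nil] at h19
  set u := toeplitzBool a (fun p => j.testBit (3 * (k - 1 - p) + 1))
    (fun p => i.testBit (k - 1 - p)) with hu
  obtain ⟨v10, l', hy', h10⟩ := scan_spec k u (fun c => j.testBit (3 * c + 2)) false
    { inp := l.tail, ss := marks, aa := true :: down (fun c => j.testBit (3 * c)) k,
      rr := down (fun c => j.testBit (3 * c + 2)) k, uu := down u k } v9 hy rfl rfl
  have h20 := h19.trans h10
  clear h19 h10
  obtain ⟨v11, T11, ho, hans, h11⟩ := check_spec (down u (level (fun p => bitVal (u p)) k - 1))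
    { inp := l.tail, ss := marks, aa := true :: down (fun c => j.testBit (3 * c)) k, rr := l',
      uu := down u (level (fun p => bitVal (u p)) k - 1) } v10 rfl
  have hlev : level (fun p => bitVal (u p)) k ≤ k :=
    (level_le_iff _ _ _).2 fun p h3 h4 => absurd h4 (Nat.not_lt.2 h3)
  refine ⟨v11, T11, ho, ?_, (h20.trans h11).mono ?_⟩
  · rw [if_pos (by omega), hans, hy', ← bitVal_machineAnswer k (q.size - p.size) i j a u rfl
      (fun c _ => rfl) hu]
    simp only [length_down, hmarks, List.length_cons, List.length_replicate]
    generalize level (fun p => bitVal (u p)) k = lev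
    have hdec : ∀ b : Bool, decide (bitVal b = 1) = b := by
      unfold bitVal
      decide
    rw [hdec]
    split_ifs <;> rfl
  · rw [length_down]
    have : level (fun p => bitVal (u p)) k - 1 ≤ k := by omega
    nlinarith

theorem length_encodeTuple (n p q i j : ℕ) :
    (encodeTuple [n, p, q, i, j]).length = n.size + p.size + q.size + i.size + j.size + 5 := by
  simp [encodeTuple, length_encodeNat]
  ring

/-- The program as a bundled machine. -/
noncomputable def entryMachine : FinTM2 where
  K := Stk
  k₀ := .inp
  k₁ := .out
  Γ := StkAlphabet
  Λ := Lbl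
  main := .readN
  σ := Reg
  initialState := {}
  Γk₀Fin := inferInstanceAs (Fintype Γ')
  m := prog

theorem initList_entryMachine (s : List Γ') :
    initList entryMachine s = cfg .readN {} { inp := s } := by
  unfold initList
  congr 1
  funext k
  cases k <;> rfl

theorem haltList_entryMachine (s : List Bool) :
    haltList entryMachine s = ⟨none, {}, ({ out := s } : Tapes).stk⟩ := by
  unfold haltList
  congr 1
  funext k
  cases k <;> rfl

/-- The run of the machine on a query. The stacks grow by at most three symbols per step, so that
cleaning up takes time linear in the length of the input and the running time so far. -/
theorem reachesIn_entryMachine (n₀ : ℕ) (e : EntryQuery n₀) :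
    ReachesIn (cfg .readN {} { inp := e.encode })
      ⟨none, {}, Tapes.stk
        { out := encodeAnswer (entryOrReject (toeplitzMatrix e.n e.ε) e.i e.j) }⟩
      (8 * e.encode.length ^ 2 + 37 * e.encode.length + 41) := by
  have hsize := Nat.size_le_size (natAbs_num_lt_den e.pos e.lt_one).le
  obtain ⟨v, T, hout, hans, h⟩ := run_spec e.n e.ε.num.natAbs e.ε.den e.i e.j hsize
  have hlen := length_encodeTuple e.n e.ε.num.natAbs e.ε.den e.i e.j
  change (e.encode).length = _ at hlen
  have htape : ∀ k, (T.stk k).length ≤ e.encode.length + 3 * _ := fun k =>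
    (h.length_le k).trans (Nat.add_le_add_right (by cases k <;> simp [Tapes.stk, EntryQuery.encode]) _)
  have h2 := h.trans (clean_spec _ T v hout htape)
  have hfin : v.ans.toList =
      encodeAnswer (entryOrReject (toeplitzMatrix e.n e.ε) e.i e.j) := by
    rw [hans, entryOrReject]
    have hiff : e.j < 2 ^ (3 * (e.n.size + 1)) ↔ e.j ≤ numCols e.n := by
      have := Nat.two_pow_pos (3 * (e.n.size + 1))
      rw [numCols, rowBits]
      omega
    by_cases hc : (1 ≤ e.i ∧ e.i ≤ e.n) ∧ 1 ≤ e.j ∧ e.j ≤ numCols e.n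
    · rw [dif_pos hc, if_pos (by rwa [hiff])]
      simp only [toeplitzMatrix, Matrix.of_apply, Nat.sub_add_cancel hc.1.1,
        Nat.sub_add_cancel hc.2.1]
      rfl
    · rw [dif_neg hc, if_neg (by rwa [hiff])]
      rfl
  rw [hfin] at h2
  refine h2.mono ?_
  rw [hlen]
  nlinarith

theorem isStronglyExplicit_toeplitzMatrix (n₀ : ℕ) :
    IsStronglyExplicit n₀ (fun n _ => numCols n) toeplitzMatrix := by
  have key : ∀ e : EntryQuery n₀, Nonempty (TM2OutputsInTime entryMachine e.encode
      (some (encodeAnswer (entryOrReject (toeplitzMatrix e.n e.ε) e.i e.j)))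
      ((8 * Polynomial.X ^ 2 + 37 * Polynomial.X + 41 : Polynomial ℕ).eval e.encode.length)) := by
    intro e
    obtain ⟨s, hs, he⟩ := reachesIn_entryMachine n₀ e
    refine ⟨⟨⟨s, ?_⟩, ?_⟩⟩
    · exact (congrArg (fun c => (flip bind entryMachine.step)^[s] (some c))
        (initList_entryMachine _)).trans (he.trans (congrArg some (haltList_entryMachine _).symm))
    · simpa using hs
  refine ⟨⟨⟨entryMachine, Equiv.refl _, Equiv.refl _⟩,
    8 * Polynomial.X ^ 2 + 37 * Polynomial.X + 41, fun e => ?_⟩⟩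
  have h := (key e).some
  have h1 : List.map (Equiv.refl (entryMachine.Γ entryMachine.k₀)).invFun e.encode = e.encode :=
    List.map_id _
  have h2 : ∀ l, List.map (Equiv.refl (entryMachine.Γ entryMachine.k₁)).invFun l = l := List.map_id
  exact h1.symm ▸ (h2 _).symm ▸ h

theorem mainTheorem6 :
    ∃ (n₀ : ℕ) (m : ℕ → ℚ → ℕ)
      (D : (n : ℕ) → (ε : ℚ) → Matrix (Fin n) (Fin (m n ε)) (ZMod 2)),
      (∀ (n : ℕ) (ε : ℚ), n₀ ≤ n → 0 < ε → ε < 1 →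
        0 < m n ε ∧ m n ε ≤ n ^ 11 ∧
        IsDistinguisher (1 / 16 : ℝ) (ε : ℝ) (D n ε) ∧
        (matrixWeight (D n ε) : ℝ) ≤ 8 * Real.logb 2 (2 * (n : ℝ)) / (ε : ℝ)) ∧
      IsStronglyExplicit n₀ m D := by
  refine ⟨2, fun n _ => numCols n, toeplitzMatrix, fun n ε hn h0 h1 => ⟨numCols_pos n,
    numCols_le hn, isDistinguisher_toeplitzMatrix (by omega) h0 h1,
    matrixWeight_toeplitzMatrix_le_logb (by omega) h0 h1⟩, isStronglyExplicit_toeplitzMatrix 2⟩
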